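/- Let $X\subset\{0,1,2\}^{\mathbb Z}$ be the vertex shift with matrix $\left[\begin{smallmatrix}1&1&0\\1&1&1\\1&1&1\end{smallmatrix}\right]$ (that is, the word $02$ is forbidden), and let $SX=(X\times\mathbb R)/\bigl((x,t+1)\sim(\sigma x,t)\bigr)$ be its mapping torus, where $\sigma$ is the left shift. Let $\mathrm{Homeo}_+(SX)$ be the group of homeomorphisms of $SX$ that map flow orbits to flow orbits preserving the orientation, let $\mathrm{MCG}(X)$ be its quotient by the homeomorphisms isotopic to the identity, and let $\pi:\mathrm{Homeo}_+(SX)\to\mathrm{MCG}(X)$ be the quotient map. An element of $\mathrm{Homeo}_+(SX)$ is called piecewise linear if, locally in the charts $(x,t)\mapsto[x,t]$, it has the form $(x,t)\mapsto(k(x),f(t))$ with $f$ piecewise linear. Let Thompson's group $V$ act on $\{0,1\}^{\mathbb N}$, and let $a,b,c\in V$ be the prefix permutations $(00\;\;01)$, $(01\;\;10\;\;11)$, $(00\;\;1)$. A local rule is a finite list of entries $u(v)w:v'$ such that in every $x\in X$ every cell belongs to the $v$-piece of exactly one occurrence of such a word $uvw$; it describes the homeomorphism of $SX$ that replaces each such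 $v$-piece by $v'$, with constant slope. Consider the following local rules, where $\alpha,\beta,\gamma$ range over $\{0,1\}$. - For $a$: $\alpha\beta(\gamma):\gamma$, $(2)2:201$, $(200):201$, $(201)\alpha:200$, $(201)2:2$, $(21)2:21$, $(21\alpha):21\alpha$. - For $b$: $\alpha\beta(\gamma):\gamma$, $(2)2:2$, $(200):200$, $(201)\alpha:210$, $(201)2:21$, $(21)2:211$, $(210)\alpha:211$, $(211):201$. - For $c$: $\alpha0(\beta):\beta$, $1(\alpha):\alpha$, $(2)2:21$, $(200):21$, $(201):201$, $(21)\alpha:200$, $(21)2:2$. Then: 1. Each of these local rules describes exactly one element of $\mathrm{Homeo}_+(SX)$, denoted $F_a,F_b,F_c$ respectively, and $F_a,F_b,F_c$ are piecewise linear. 2. Each of the words $aa$, $bbb$, $cc$, $abababab$, $cacaca$, $cabbabacabbabacbcababbacababba$, $acbcbabbcbbcbcabcbbcabbacbbcbcbabb$, $abbcbcabbabbcbcbbabbcbbcbabcbbcabb$, $cabbcbbcbacabacbcbbcabbcabcbbcbbacbacbcbbcabb$ (relators of a finite presentation of $V$), evaluated at $F_a,F_b,F_c$ acting from the right, is the identity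 homeomorphism of $SX$. 3. There is an injective homomorphism $\iota:V\to\mathrm{MCG}(X)$ with $\iota(a)=\pi(F_a)$, $\iota(b)=\pi(F_b)$, $\iota(c)=\pi(F_c)$, and $\pi$ splits over its image: there is a homomorphism $s:\iota(V)\to\mathrm{Homeo}_+(SX)$ with $\pi\circ s=\mathrm{id}$, with only piecewise linear homeomorphisms in its image, and with $s(\iota(a))=F_a$, $s(\iota(b))=F_b$, $s(\iota(c))=F_c$. -/

import Mathlib

open Topology

/-! ## Thompson's group `V` -/

/-- Cantor space `{0,1}^ℕ`, with `false` for `0` and `true` for `1`. -/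
abbrev Cantor : Type := ℕ → Bool

/-- The infinite word `u y`. -/
def prepend (u : List Bool) (y : Cantor) : Cantor :=
  fun n => if h : n < u.length then u[n] else y (n - u.length)

theorem prepend_append (u v : List Bool) (y : Cantor) :
    prepend (u ++ v) y = prepend u (prepend v y) := by
  funext n
  simp only [prepend, List.length_append]
  by_cases h1 : n < u.length
  · have h2 : n < u.length + v.length := by omega
    simp [h1, h2, List.getElem_append_left]
  · by_cases h2 : n < u.length + v.length
    · have h3 : n - u.length < v.length := by omega
      simp [h1, h2, h3, List.getElem_append_right (Nat.le_of_not_lt h1)]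
    · have h3 : ¬ n - u.length < v.length := by omega
      simp [h1, h2, h3, Nat.sub_sub]

theorem prepend_comparable {u v : List Bool} {y z : Cantor} (h : prepend u y = prepend v z)
    (hl : u.length ≤ v.length) : ∃ r, v = u ++ r := by
  refine ⟨v.drop u.length, ?_⟩
  have : u = v.take u.length := by
    apply List.ext_getElem
    · simp [hl]
    · intro i h1 h2
      have hi := congrFun h i
      simp only [prepend, h1, dif_pos, lt_of_lt_of_le h1 hl] at hi
      simpa using hi
  conv_lhs => rw [← List.take_append_drop u.length v, ← this]

theorem prepend_injective (u : List Bool) : Function.Injective (prepend u) := by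
  intro y z h
  funext n
  have := congrFun h (n + u.length)
  simpa [prepend] using this

/-- `g` is a prefix replacement map: there is a finite table of pairs of words `(u, v)` such that
every infinite word begins with some `u` of the table, and `g (u y) = v y` for all pairs `(u, v)`
of the table and all infinite words `y`. -/
def IsPrefixReplacement (g : Equiv.Perm Cantor) : Prop :=
  ∃ P : Finset (List Bool × List Bool),
    (∀ x : Cantor, ∃ p ∈ P, ∃ y, x = prepend p.1 y) ∧
    ∀ p ∈ P, ∀ y, g (prepend p.1 y) = prepend p.2 y

theorem IsPrefixReplacement.mul {g f : Equiv.Perm Cantor} (hg : IsPrefixReplacement g)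
    (hf : IsPrefixReplacement f) : IsPrefixReplacement (g * f) := by
  classical
  obtain ⟨P, hP, hP'⟩ := hf
  obtain ⟨Q, hQ, hQ'⟩ := hg
  let F : (List Bool × List Bool) × (List Bool × List Bool) → List Bool × List Bool :=
    fun t => (t.1.1 ++ t.2.1.drop t.1.2.length, t.2.2 ++ t.1.2.drop t.2.1.length)
  refine ⟨((P ×ˢ Q).image F).filter
    (fun r => ∀ y, (g * f) (prepend r.1 y) = prepend r.2 y), ?_, ?_⟩
  · intro x
    obtain ⟨p, hp, y, rfl⟩ := hP x
    obtain ⟨q, hq, z, hz⟩ := hQ (prepend p.2 y)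
    rcases le_total p.2.length q.1.length with hl | hl
    · obtain ⟨r, hr⟩ := prepend_comparable hz hl
      have hF : F (p, q) = (p.1 ++ r, q.2) := by simp [F, hr]
      refine ⟨F (p, q), ?_, z, ?_⟩
      · refine Finset.mem_filter.2 ⟨Finset.mem_image_of_mem _ (Finset.mk_mem_product hp hq), ?_⟩
        intro y'
        rw [hF, Equiv.Perm.mul_apply, prepend_append, hP' p hp, ← prepend_append, ← hr, hQ' q hq]
      · rw [hr, prepend_append] at hz
        rw [hF, prepend_append, prepend_injective _ hz]
    · obtain ⟨r, hr⟩ := prepend_comparable hz.symm hl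
      have hF : F (p, q) = (p.1, q.2 ++ r) := by simp [F, hr]
      refine ⟨F (p, q), ?_, y, by rw [hF]⟩
      refine Finset.mem_filter.2 ⟨Finset.mem_image_of_mem _ (Finset.mk_mem_product hp hq), ?_⟩
      intro y'
      rw [hF, Equiv.Perm.mul_apply, hP' p hp, hr, prepend_append, hQ' q hq, ← prepend_append]
  · intro r hr
    exact (Finset.mem_filter.1 hr).2

theorem IsPrefixReplacement.inv {g : Equiv.Perm Cantor} (hg : IsPrefixReplacement g) :
    IsPrefixReplacement g⁻¹ := by
  classical
  obtain ⟨P, hP, hP'⟩ := hg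
  refine ⟨P.image Prod.swap, ?_, ?_⟩
  · intro x
    obtain ⟨p, hp, y, hy⟩ := hP (g⁻¹ x)
    refine ⟨p.swap, Finset.mem_image_of_mem _ hp, y, ?_⟩
    rw [Prod.fst_swap, ← hP' p hp, ← hy]
    exact (g.apply_symm_apply x).symm
  · intro q hq y
    obtain ⟨p, hp, rfl⟩ := Finset.mem_image.1 hq
    rw [Prod.fst_swap, Prod.snd_swap, ← hP' p hp]
    exact g.symm_apply_apply _

/-- Thompson's group `V`, as a group of permutations of Cantor space. -/
def thompsonV : Subgroup (Equiv.Perm Cantor) where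
  carrier := {g | IsPrefixReplacement g}
  mul_mem' hg hf := IsPrefixReplacement.mul hg hf
  one_mem' := ⟨{([], [])}, fun x => ⟨_, Finset.mem_singleton_self _, x, by funext n; simp [prepend]⟩,
    fun p hp y => by rw [Finset.mem_singleton.1 hp]; rfl⟩
  inv_mem' hg := IsPrefixReplacement.inv hg

/-- The word `u` is a prefix of `x`. -/
def HasPrefix (u : List Bool) (x : Cantor) : Prop := ∀ i : Fin u.length, x i = u[i]

instance (u : List Bool) (x : Cantor) : Decidable (HasPrefix u x) := by
  unfold HasPrefix; infer_instance

/-- Rewrite the prefix of `x` according to the first entry `(u, v)` of the table such that `u` is a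
prefix of `x`, and fix `x` if there is no such entry. -/
def rewritePrefix : List (List Bool × List Bool) → Cantor → Cantor
  | [], x => x
  | (u, v) :: T, x =>
    if HasPrefix u x then prepend v (fun n => x (n + u.length)) else rewritePrefix T x

/-- The names of the three generators. -/
inductive Gen
  | a
  | b
  | c

/-- The prefix permutations `a = (00 01)`, `b = (01 10 11)`, `c = (00 1)`. -/
def Gen.prefixTable : Gen → List (List Bool × List Bool)
  | .a => [([false, false], [false, true]), ([false, true], [false, false])]
  | .b => [([false, true], [true, false]), ([true, false], [true, true]),
      ([true, true], [false, true])]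
  | .c => [([false, false], [true]), ([true], [false, false])]

/-- The prefix permutations inverse to `a`, `b`, `c`. -/
def Gen.prefixTableInv : Gen → List (List Bool × List Bool)
  | .a => [([false, false], [false, true]), ([false, true], [false, false])]
  | .b => [([true, false], [false, true]), ([true, true], [true, false]),
      ([false, true], [true, true])]
  | .c => [([false, false], [true]), ([true], [false, false])]
theorem Gen.left_inv (s : Gen) (x : Cantor) :
    rewritePrefix s.prefixTableInv (rewritePrefix s.prefixTable x) = x := by
  rcases s <;> rcases h0 : x 0 <;> rcases h1 : x 1 <;> funext n <;>
    rcases n with _ | _ | n <;>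
    simp [rewritePrefix, Gen.prefixTable, Gen.prefixTableInv, HasPrefix, prepend, Fin.forall_fin_succ, h0, h1]

theorem Gen.right_inv (s : Gen) (x : Cantor) :
    rewritePrefix s.prefixTable (rewritePrefix s.prefixTableInv x) = x := by
  rcases s <;> rcases h0 : x 0 <;> rcases h1 : x 1 <;> funext n <;>
    rcases n with _ | _ | n <;>
    simp [rewritePrefix, Gen.prefixTable, Gen.prefixTableInv, HasPrefix, prepend,
      Fin.forall_fin_succ, h0, h1]

/-- The prefix permutation of Cantor space named by a generator. -/
def Gen.perm (s : Gen) : Equiv.Perm Cantor where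
  toFun := rewritePrefix s.prefixTable
  invFun := rewritePrefix s.prefixTableInv
  left_inv := s.left_inv
  right_inv := s.right_inv

theorem Gen.perm_mem (s : Gen) : s.perm ∈ thompsonV := by
  refine ⟨match s with
    | .a => {([false, false], [false, true]), ([false, true], [false, false]), ([true], [true])}
    | .b => {([false, false], [false, false]), ([false, true], [true, false]),
        ([true, false], [true, true]), ([true, true], [false, true])}
    | .c => {([false, false], [true]), ([true], [false, false]),
        ([false, true], [false, true])}, ?_, ?_⟩
  · intro x
    have h1 : x = prepend [x 0] (fun n => x (n + 1)) := by
      funext n; rcases n with _ | n <;> simp [prepend]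
    have h2 : x = prepend [x 0, x 1] (fun n => x (n + 2)) := by
      funext n; rcases n with _ | _ | n <;> simp [prepend]
    rcases s <;> rcases h0 : x 0 <;> rcases h1' : x 1 <;> rw [h0] at h1 <;> rw [h0, h1'] at h2 <;>
      first
      | exact ⟨_, by simp; exact Or.inl rfl, _, h2⟩
      | exact ⟨_, by simp; exact Or.inr (Or.inl rfl), _, h2⟩
      | exact ⟨_, by simp; exact Or.inr (Or.inr (Or.inl rfl)), _, h2⟩
      | exact ⟨_, by simp; exact Or.inr (Or.inr (Or.inr rfl)), _, h2⟩
      | exact ⟨_, by simp; exact Or.inr (Or.inr rfl), _, h2⟩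
      | exact ⟨_, by simp; exact Or.inr (Or.inr rfl), _, h1⟩
      | exact ⟨_, by simp; exact Or.inr (Or.inl rfl), _, h1⟩
  · intro p hp y
    rcases s <;> simp only [Finset.mem_insert, Finset.mem_singleton] at hp <;>
      rcases hp with rfl | rfl | rfl | rfl <;> funext n <;> rcases n with _ | _ | n <;>
      simp [Gen.perm, rewritePrefix, Gen.prefixTable, HasPrefix, prepend, Fin.forall_fin_succ]

/-- The generators `a`, `b`, `c` of Thompson's group `V`. -/
def Gen.toV (s : Gen) : thompsonV := ⟨s.perm, s.perm_mem⟩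

/-- The defining relators of `V` in the generators `a`, `b`, `c`; words act from the right, that
is, the first letter of a word acts first. -/
def relators : List (List Gen) :=
  [[.a, .a],
   [.b, .b, .b],
   [.c, .c],
   [.a, .b, .a, .b, .a, .b, .a, .b],
   [.c, .a, .c, .a, .c, .a],
   [.c, .a, .b, .b, .a, .b, .a, .c, .a, .b, .b, .a, .b, .a, .c, .b, .c, .a, .b, .a, .b, .b, .a,
     .c, .a, .b, .a, .b, .b, .a],
   [.a, .c, .b, .c, .b, .a, .b, .b, .c, .b, .b, .c, .b, .c, .a, .b, .c, .b, .b, .c, .a, .b, .b,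
     .a, .c, .b, .b, .c, .b, .c, .b, .a, .b, .b],
   [.a, .b, .b, .c, .b, .c, .a, .b, .b, .a, .b, .b, .c, .b, .c, .b, .b, .a, .b, .b, .c, .b, .b,
     .c, .b, .a, .b, .c, .b, .b, .c, .a, .b, .b],
   [.c, .a, .b, .b, .c, .b, .b, .c, .b, .a, .c, .a, .b, .a, .c, .b, .c, .b, .b, .c, .a, .b, .b,
     .c, .a, .b, .c, .b, .b, .c, .b, .b, .a, .c, .b, .a, .c, .b, .c, .b, .b, .c, .a, .b, .b]]

/-! ## Vertex shifts and their mapping tori -/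

section Torus

variable {n : ℕ} (M : Matrix (Fin n) (Fin n) ℕ)

/-- The vertex shift of a 0-1 matrix: all bi-infinite walks in the graph with adjacency matrix
`M`, with the topology induced by the product topology. -/
def VertexShift : Type := {x : ℤ → Fin n // ∀ i, M (x i) (x (i + 1)) = 1}

instance : TopologicalSpace (VertexShift M) :=
  inferInstanceAs (TopologicalSpace {x : ℤ → Fin n // ∀ i, M (x i) (x (i + 1)) = 1})

variable {M}

/-- The `m`-th power of the left shift. -/
def VertexShift.shift (m : ℤ) (x : VertexShift M) : VertexShift M :=
  ⟨fun i => x.1 (i + m), fun i => by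
    have := x.2 (i + m)
    rwa [show i + m + 1 = i + 1 + m by ring] at this⟩

theorem VertexShift.shift_zero (x : VertexShift M) : x.shift 0 = x :=
  Subtype.ext (funext fun i => congrArg x.1 (add_zero i))

theorem VertexShift.shift_shift (m k : ℤ) (x : VertexShift M) :
    (x.shift m).shift k = x.shift (k + m) :=
  Subtype.ext (funext fun i => congrArg x.1 (add_assoc i k m))

variable (M)

/-- The relation `(x, t + 1) ∼ (σ x, t)` on `X × ℝ`, where `σ` is the left shift. -/
def torusSetoid : Setoid (VertexShift M × ℝ) where
  r p q := ∃ m : ℤ, q.1 = p.1.shift m ∧ p.2 = q.2 + m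
  iseqv := by
    refine ⟨fun p => ⟨0, p.1.shift_zero.symm, by simp⟩, ?_, ?_⟩
    · rintro p q ⟨m, h1, h2⟩
      refine ⟨-m, ?_, by rw [h2]; push_cast; ring⟩
      rw [h1, VertexShift.shift_shift, neg_add_cancel, VertexShift.shift_zero]
    · rintro p q r ⟨m, h1, h2⟩ ⟨k, h3, h4⟩
      refine ⟨k + m, ?_, by rw [h2, h4]; push_cast; ring⟩
      rw [h3, h1, VertexShift.shift_shift]

/-- The mapping torus of the vertex shift, with the quotient topology. -/
def MappingTorus : Type := Quotient (torusSetoid M)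

instance : TopologicalSpace (MappingTorus M) :=
  inferInstanceAs (TopologicalSpace (Quotient (torusSetoid M)))

variable {M}

/-- The point at position `t` of the tiling of the line by unit tiles in which the tile `[i, i+1]`
carries the symbol `x i`. -/
def torusMk (x : VertexShift M) (t : ℝ) : MappingTorus M := Quotient.mk (torusSetoid M) (x, t)

/-- The flow of `ℝ` on the mapping torus. -/
def flow (t : ℝ) : MappingTorus M → MappingTorus M :=
  Quotient.map (fun p => (p.1, p.2 + t)) (by
    rintro p q ⟨m, h1, h2⟩
    exact ⟨m, h1, by simp only [h2]; ring⟩)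

/-- `h` maps every flow orbit onto a flow orbit in an orientation preserving way. -/
def IsOrientationPreserving (h : MappingTorus M ≃ₜ MappingTorus M) : Prop :=
  ∀ p, ∃ θ : ℝ ≃o ℝ, ∀ t, h (flow t p) = flow (θ t) (h p)

variable (M)

/-- The group of orientation preserving homeomorphisms of the mapping torus. -/
def OPHomeo : Subgroup (MappingTorus M ≃ₜ MappingTorus M) where
  carrier := {h | IsOrientationPreserving h}
  one_mem' := fun _ => ⟨OrderIso.refl ℝ, fun _ => rfl⟩
  mul_mem' := by
    intro g h hg hh p
    obtain ⟨θ, hθ⟩ := hh p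
    obtain ⟨η, hη⟩ := hg (h p)
    exact ⟨θ.trans η, fun t => by
      rw [Homeomorph.mul_apply, Homeomorph.mul_apply, hθ, hη]; rfl⟩
  inv_mem' := by
    intro h hh p
    obtain ⟨θ, hθ⟩ := hh (h.symm p)
    refine ⟨θ.symm, fun t => ?_⟩
    change h.symm (flow t p) = flow (θ.symm t) (h.symm p)
    rw [Homeomorph.symm_apply_eq, hθ, OrderIso.apply_symm_apply, Homeomorph.apply_symm_apply]

/-- The homeomorphisms that are isotopic to the identity. -/
def isotopicToId : Subgroup (OPHomeo M) where
  carrier := {h | ∃ H : unitInterval → OPHomeo M,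
    Continuous (fun q : unitInterval × MappingTorus M => (H q.1).1 q.2) ∧ H 0 = 1 ∧ H 1 = h}
  one_mem' := ⟨fun _ => 1, continuous_snd, rfl, rfl⟩
  mul_mem' := by
    rintro g h ⟨G, hG, hG0, hG1⟩ ⟨H, hH, hH0, hH1⟩
    refine ⟨fun t => G t * H t, ?_, by simp [hG0, hH0], by simp [hG1, hH1]⟩
    exact hG.comp (continuous_fst.prodMk hH)
  inv_mem' := by
    rintro h ⟨H, hH, hH0, hH1⟩
    refine ⟨fun t => H (unitInterval.symm t) * h⁻¹, ?_, by simp [hH1], by simp [hH0]⟩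
    exact hH.comp ((unitInterval.continuous_symm.comp continuous_fst).prodMk
      ((h⁻¹).1.continuous.comp continuous_snd))

instance : (isotopicToId M).Normal where
  conj_mem := by
    rintro h ⟨H, hH, hH0, hH1⟩ g
    refine ⟨fun t => g * H t * g⁻¹, ?_, by simp [hH0], by simp [hH1]⟩
    exact g.1.continuous.comp (hH.comp (continuous_fst.prodMk
      ((g⁻¹).1.continuous.comp continuous_snd)))

/-- The mapping class group: orientation preserving homeomorphisms of the mapping torus up to
isotopy. -/
abbrev MCG : Type := OPHomeo M ⧸ isotopicToId M

variable {M}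

/-- `h` is piecewise linear: near every point of the mapping torus, `h` is in the product charts
`(x, t) ↦ [x, t]` the product of a map of the totally disconnected factor with a piecewise linear
map of an interval (with one possible break at the point in question). -/
def IsPiecewiseLinear (h : OPHomeo M) : Prop :=
  ∀ (x : VertexShift M) (t : ℝ), ∃ U ∈ 𝓝 x, ∃ ε > (0 : ℝ), ∃ (k : VertexShift M → VertexShift M)
    (r slopeL slopeR : ℝ), ∀ x' ∈ U, ∀ s : ℝ, 0 ≤ s → s < ε →
      h.1 (torusMk x' (t + s)) = torusMk (k x') (r + slopeR * s) ∧
      h.1 (torusMk x' (t - s)) = torusMk (k x') (r - slopeL * s)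

/-- The word `u` occurs in `x` at position `p`. -/
def OccursAt (u : List (Fin n)) (x : VertexShift M) (p : ℤ) : Prop :=
  ∀ j : Fin u.length, x.1 (p + (j : ℤ)) = u[j]

end Torus

/-! ## Local rules -/

/-- An entry `u(v)w : v'` of a local rule. -/
structure RuleEntry (n : ℕ) where
  /-- the left context -/
  u : List (Fin n)
  /-- the word that is replaced -/
  v : List (Fin n)
  /-- the right context -/
  w : List (Fin n)
  /-- the word that replaces `v` -/
  v' : List (Fin n)

section Rules

variable {n : ℕ} {M : Matrix (Fin n) (Fin n) ℕ}

/-- The word `uvw` occurs in `x` with its `v`-piece starting at position `p`. -/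
def RuleEntry.AppliesAt (e : RuleEntry n) (x : VertexShift M) (p : ℤ) : Prop :=
  OccursAt (e.u ++ e.v ++ e.w) x (p - e.u.length)

/-- `h` is the homeomorphism described by the local rule `R`: in every configuration every cell
belongs to the `v`-piece of exactly one occurrence of a word `uvw` with `u(v)w : v'` in `R`, and `h`
replaces each such `v`-piece by `v'`, with constant slope. (Consecutive `v`-pieces share an
endpoint, so consecutive words `v'` are consecutive in the image.) -/
def Implements (h : OPHomeo M) (R : List (RuleEntry n)) : Prop :=
  (∀ (x : VertexShift M) (i : ℤ), ∃! q : RuleEntry n × ℤ,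
    q.1 ∈ R ∧ q.1.AppliesAt x q.2 ∧ q.2 ≤ i ∧ i < q.2 + q.1.v.length) ∧
  ∀ (x : VertexShift M), ∀ e ∈ R, ∀ p : ℤ, e.AppliesAt x p →
    ∃ y : VertexShift M, OccursAt e.v' y 0 ∧ ∀ s ∈ Set.Icc (0 : ℝ) 1,
      h.1 (torusMk x (p + s * e.v.length)) = torusMk y (s * e.v'.length)

end Rules

/-- The matrix of the vertex shift; the only forbidden word is `02`. -/
def matX : Matrix (Fin 3) (Fin 3) ℕ := !![1, 1, 0; 1, 1, 1; 1, 1, 1]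

/-- The symbols `0` and `1`. -/
def bits : List (Fin 3) := [0, 1]

/-- The local rules for the generators `a`, `b`, `c`. -/
def Gen.rule : Gen → List (RuleEntry 3)
  | .a =>
    (bits.flatMap fun α => bits.flatMap fun β => bits.map fun γ => ⟨[α, β], [γ], [], [γ]⟩) ++
    [⟨[], [2], [2], [2, 0, 1]⟩, ⟨[], [2, 0, 0], [], [2, 0, 1]⟩] ++
    (bits.map fun α => ⟨[], [2, 0, 1], [α], [2, 0, 0]⟩) ++
    [⟨[], [2, 0, 1], [2], [2]⟩, ⟨[], [2, 1], [2], [2, 1]⟩] ++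
    (bits.map fun α => ⟨[], [2, 1, α], [], [2, 1, α]⟩)
  | .b =>
    (bits.flatMap fun α => bits.flatMap fun β => bits.map fun γ => ⟨[α, β], [γ], [], [γ]⟩) ++
    [⟨[], [2], [2], [2]⟩, ⟨[], [2, 0, 0], [], [2, 0, 0]⟩] ++
    (bits.map fun α => ⟨[], [2, 0, 1], [α], [2, 1, 0]⟩) ++
    [⟨[], [2, 0, 1], [2], [2, 1]⟩, ⟨[], [2, 1], [2], [2, 1, 1]⟩] ++
    (bits.map fun α => ⟨[], [2, 1, 0], [α], [2, 1, 1]⟩) ++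
    [⟨[], [2, 1, 1], [], [2, 0, 1]⟩]
  | .c =>
    (bits.flatMap fun α => bits.map fun β => ⟨[α, 0], [β], [], [β]⟩) ++
    (bits.map fun α => ⟨[1], [α], [], [α]⟩) ++
    [⟨[], [2], [2], [2, 1]⟩, ⟨[], [2, 0, 0], [], [2, 1]⟩, ⟨[], [2, 0, 1], [], [2, 0, 1]⟩] ++
    (bits.map fun α => ⟨[], [2, 1], [α], [2, 0, 0]⟩) ++
    [⟨[], [2, 1], [2], [2]⟩]

/-- The homeomorphism obtained by letting the word `w` act from the right (first letter first). -/
def actWord (F : Gen → OPHomeo matX) (w : List Gen) : OPHomeo matX :=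
  w.foldl (fun h s => F s * h) 1

/-! Cut a configuration at its symbols `2`. Since `02` is forbidden, a finite block is `2w` with `w`
a binary word not ending in `0`, and such words correspond bijectively to the eventually vanishing
sequences `w000...` of Cantor space. Prefix replacements permute these sequences, so an element of
`V` acts on configurations block by block, changing the lengths of the blocks.

To get an action by homeomorphisms, and not just up to isotopy, each block of length `m` is
identified with the unit interval by a fixed parametrization `stretch m`, and a block of length `m`
is mapped to one of length `m'` by `restretch m m' = stretch m' * (stretch m)⁻¹`. These maps compose
strictly (`restretch_trans`). The map must also be local, since blocks can be infinite: an element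
of `V` changes only a bounded prefix, so the rest of a long block has to be translated rigidly. This
is arranged by building `stretch` from powers of one map `pushRight` that is a translation beyond
`2`; then `restretch (m + j) (m' + j) = restretch m m'` (`restretch_add`). Hence a table of bounded
depth gives a finite local description (`UniformTable.code`), a continuous piecewise linear map, and
`UniformTable.actsBlockwise`.

Configurations cut into finite blocks are dense, so a continuous map is determined by its action on
blocks (`ActsBlockwise.unique`). This one principle gives independence of the table, inverses, the
homomorphism `blockAction`, and thereby the relators, which only need to be checked in `V`.

Faithfulness up to isotopy: the transversal is totally disconnected, so an isotopy moves points
along flow orbits only. Applied to a block preceded by symbols `1` only, this shows that the block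
is fixed; thus an element isotopic to the identity fixes all eventually vanishing sequences, which
are dense, and is trivial. The section over the image is `blockAction` after the inverse of the
embedding.

Finally, `pushRight` has slope `3 / 2` before `2`, which makes the parametrizations of lengths up to
three linear and the map from length three to four linear on the first two cells and on the third.
This is the constant slope required by the local rules. That the rules cut every configuration
unambiguously is a finite check on windows. -/

/-! ### Topology of the mapping torus, lifting of curves, isotopies -/

section TorusTopology

variable {n : ℕ} {M : Matrix (Fin n) (Fin n) ℕ}

instance : T2Space (VertexShift M) :=
  inferInstanceAs (T2Space {x : ℤ → Fin n // ∀ i, M (x i) (x (i + 1)) = 1})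

instance : TotallyDisconnectedSpace (VertexShift M) :=
  inferInstanceAs (TotallyDisconnectedSpace {x : ℤ → Fin n // ∀ i, M (x i) (x (i + 1)) = 1})

theorem VertexShift.continuous_apply (i : ℤ) : Continuous fun x : VertexShift M => x.1 i :=
  (_root_.continuous_apply i).comp continuous_subtype_val

theorem VertexShift.continuous_mk {Y : Type*} [TopologicalSpace Y] {f : Y → VertexShift M}
    (hf : ∀ i, Continuous fun y => (f y).1 i) : Continuous f :=
  continuous_induced_rng.2 (continuous_pi hf)

instance : CompactSpace (VertexShift M) := by
  refine isCompact_iff_compactSpace.1 (IsClosed.isCompact (X := ℤ → Fin n)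
    (s := {x | ∀ i, M (x i) (x (i + 1)) = 1}) ?_)
  rw [Set.ofPred_forall]
  refine isClosed_iInter fun i => ?_
  have : Continuous fun x : ℤ → Fin n => M (x i) (x (i + 1)) :=
    Continuous.comp (g := fun p : Fin n × Fin n => M p.1 p.2)
      (f := fun x : ℤ → Fin n => (x i, x (i + 1))) continuous_of_discreteTopology
      ((_root_.continuous_apply i).prodMk (_root_.continuous_apply (i + 1)))
  exact isClosed_eq this continuous_const

theorem VertexShift.continuous_shift (m : ℤ) : Continuous (VertexShift.shift m (M := M)) :=
  VertexShift.continuous_mk fun i => VertexShift.continuous_apply (i + m)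

theorem VertexShift.shift_apply (m : ℤ) (x : VertexShift M) (i : ℤ) :
    (x.shift m).1 i = x.1 (i + m) := rfl

theorem torusMk_eq_iff {x y : VertexShift M} {s t : ℝ} :
    torusMk x s = torusMk y t ↔ ∃ m : ℤ, y = x.shift m ∧ s = t + m :=
  Quotient.eq (r := torusSetoid M)

theorem torusMk_shift (x : VertexShift M) (m : ℤ) (t : ℝ) :
    torusMk (x.shift m) t = torusMk x (t + m) :=
  (torusMk_eq_iff.2 ⟨m, rfl, rfl⟩).symm

theorem torusMk_injective_left {x y : VertexShift M} {t : ℝ} (h : torusMk x t = torusMk y t) :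
    x = y := by
  obtain ⟨m, rfl, h⟩ := torusMk_eq_iff.1 h
  obtain rfl : m = 0 := by exact_mod_cast (by linarith : (m : ℝ) = 0)
  exact x.shift_zero.symm

theorem flow_torusMk (x : VertexShift M) (s t : ℝ) : flow t (torusMk x s) = torusMk x (s + t) := rfl

theorem torusMk_surjective (p : MappingTorus M) :
    ∃ x : VertexShift M, ∃ t, p = torusMk x t := by
  induction p using Quotient.inductionOn with | h p => exact ⟨p.1, p.2, rfl⟩

theorem continuous_torusMk : Continuous fun p : VertexShift M × ℝ => torusMk p.1 p.2 :=
  continuous_quotient_mk'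

theorem isQuotientMap_torusMk :
    IsQuotientMap fun p : VertexShift M × ℝ => torusMk p.1 p.2 :=
  isQuotientMap_quotient_mk'

theorem continuous_torusMk_comp {Y : Type*} [TopologicalSpace Y] {f : Y → VertexShift M}
    {g : Y → ℝ} (hf : Continuous f) (hg : Continuous g) :
    Continuous fun y => torusMk (f y) (g y) :=
  continuous_torusMk.comp (hf.prodMk hg)

/-- The deck transformations of `X × ℝ` over the mapping torus. -/
instance : AddAction ℤ (VertexShift M × ℝ) where
  vadd m p := (p.1.shift m, p.2 - m)
  zero_vadd p := Prod.ext p.1.shift_zero (by change p.2 - ((0 : ℤ) : ℝ) = p.2; simp)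
  add_vadd m k p := Prod.ext (by
      change p.1.shift (m + k) = (p.1.shift k).shift m
      rw [VertexShift.shift_shift])
    (by change p.2 - ((m + k : ℤ) : ℝ) = p.2 - k - m; push_cast; ring)

theorem deck_vadd_def (m : ℤ) (p : VertexShift M × ℝ) : m +ᵥ p = (p.1.shift m, p.2 - m) := rfl

instance : ContinuousConstVAdd ℤ (VertexShift M × ℝ) where
  continuous_const_vadd m :=
    ((VertexShift.continuous_shift m).comp continuous_fst).prodMk
      (continuous_snd.sub continuous_const)

theorem torusMk_eq_iff_mem_orbit {p q : VertexShift M × ℝ} :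
    torusMk p.1 p.2 = torusMk q.1 q.2 ↔ p ∈ AddAction.orbit ℤ q := by
  rw [eq_comm, torusMk_eq_iff, AddAction.mem_orbit_iff]
  refine exists_congr fun m => ?_
  rw [deck_vadd_def, Prod.ext_iff]
  exact and_congr eq_comm ⟨fun h => by simp [h], fun h => by simp [← h]⟩

theorem isAddQuotientCoveringMap_torusMk :
    IsAddQuotientCoveringMap (fun p : VertexShift M × ℝ => torusMk p.1 p.2) ℤ where
  toIsQuotientMap := isQuotientMap_torusMk
  toContinuousConstVAdd := inferInstance
  apply_eq_iff_mem_orbit := torusMk_eq_iff_mem_orbit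
  disjoint p := by
    -- Two points of a ball of radius `1 / 2` differ by less than `1`, so only the trivial deck
    -- transformation can relate them.
    refine ⟨Prod.snd ⁻¹' Metric.ball p.2 (1 / 2),
      continuous_snd.continuousAt.preimage_mem_nhds (Metric.ball_mem_nhds _ (by norm_num)), ?_⟩
    rintro m ⟨_, ⟨q, hq, rfl⟩, hq'⟩
    simp only [Set.mem_preimage, Metric.mem_ball, Real.dist_eq, deck_vadd_def, abs_lt] at hq hq'
    have h1 : (m : ℝ) < 1 := by linarith
    have h2 : (-1 : ℝ) < m := by linarith
    have h1' : m < 1 := by exact_mod_cast h1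
    have h2' : -1 < m := by exact_mod_cast h2
    omega

/-- The deck group acts properly discontinuously on a locally compact Hausdorff space: a deck
transformation by `m` that moves a point of `K` into `L` changes the real coordinate by `m`, which
bounds `m`. -/
instance : T2Space (MappingTorus M) := by
  have : ProperlyDiscontinuousVAdd ℤ (VertexShift M × ℝ) := ⟨by
    intro K L hK hL
    obtain ⟨a, ha⟩ := (hK.image continuous_snd).isBounded.exists_norm_le
    obtain ⟨b, hb⟩ := (hL.image continuous_snd).isBounded.exists_norm_le
    refine (Set.finite_Icc (-⌈a + b⌉) ⌈a + b⌉).subset ?_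
    rintro m hm
    obtain ⟨_, ⟨q, hq, rfl⟩, hq'⟩ := hm
    have h1 := abs_le.1 (ha _ (Set.mem_image_of_mem _ hq))
    have h2 := abs_le.1 (hb _ (Set.mem_image_of_mem _ hq'))
    simp only [deck_vadd_def] at h2
    have h3 := Int.le_ceil (a + b)
    have h4 : (m : ℝ) ≤ (⌈a + b⌉ : ℝ) := by linarith [h1.1, h1.2, h2.1, h2.2]
    have h5 : (-⌈a + b⌉ : ℝ) ≤ m := by linarith [h1.1, h1.2, h2.1, h2.2]
    exact ⟨by exact_mod_cast h5, by exact_mod_cast h4⟩⟩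
  have h : torusSetoid M = AddAction.orbitRel ℤ (VertexShift M × ℝ) :=
    Setoid.ext fun p q => (torusMk_eq_iff (x := p.1) (s := p.2) (y := q.1) (t := q.2)).symm.trans
      torusMk_eq_iff_mem_orbit
  change T2Space (Quotient (torusSetoid M))
  rw [h]
  infer_instance

/-- A curve in the mapping torus stays in one flow orbit. -/
theorem exists_lift_curve {γ : ℝ → MappingTorus M} (hγ : Continuous γ) :
    ∃ (y : VertexShift M) (θ : ℝ → ℝ), Continuous θ ∧ ∀ t, γ t = torusMk y (θ t) := by
  obtain ⟨y, s, h⟩ := torusMk_surjective (γ 0)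
  obtain ⟨Γ, ⟨-, hΓ⟩, -⟩ :=
    (isAddQuotientCoveringMap_torusMk (M := M)).isCoveringMap.existsUnique_continuousMap_lifts
      ⟨γ, hγ⟩ 0 (y, s) h.symm
  refine ⟨(Γ 0).1, fun t => (Γ t).2, continuous_snd.comp Γ.continuous, fun t => ?_⟩
  have hc : Continuous fun t => (Γ t).1 := continuous_fst.comp Γ.continuous
  -- The configuration coordinate of the lift is a continuous map from the line to a totally
  -- disconnected space, hence constant.
  have : (Γ 0).1 = (Γ t).1 :=
    (isPreconnected_univ.image _ hc.continuousOn).subsingleton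
      ⟨0, Set.mem_univ _, rfl⟩ ⟨t, Set.mem_univ _, rfl⟩
  rw [this]
  exact (congrFun hΓ t).symm

/-- Two lifts of a curve differ by a deck transformation. -/
theorem sub_eq_const_of_torusMk_eq {y y' : VertexShift M} {θ θ' : ℝ → ℝ} {S : Set ℝ}
    (hS : IsPreconnected S) (hθ : ContinuousOn θ S) (hθ' : ContinuousOn θ' S)
    (h : ∀ t ∈ S, torusMk y (θ t) = torusMk y' (θ' t)) {a b : ℝ} (ha : a ∈ S) (hb : b ∈ S) :
    θ b - θ' b = θ a - θ' a := by
  have hint : ∀ t ∈ S, ∃ m : ℤ, θ t - θ' t = m := fun t ht => by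
    obtain ⟨m, -, hm⟩ := torusMk_eq_iff.1 (h t ht)
    exact ⟨m, by rw [hm]; ring⟩
  have hpre : IsPreconnected ((fun t => θ t - θ' t) '' S) := hS.image _ (hθ.sub hθ')
  by_contra hne
  -- The difference takes integer values on a connected set; two distinct values would force a
  -- half-integer in between.
  have key : ∀ u v : ℝ, u ∈ (fun t => θ t - θ' t) '' S → v ∈ (fun t => θ t - θ' t) '' S →
      ¬ u < v := by
    rintro u v hu hv huv
    have hsub := hpre.Icc_subset hu hv
    obtain ⟨t, ht, rfl⟩ := hu
    obtain ⟨t', ht', rfl⟩ := hv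
    obtain ⟨m, hm⟩ := hint t ht
    obtain ⟨k, hk⟩ := hint t' ht'
    simp only [hm, hk] at huv hsub
    have hmk : m + 1 ≤ k := by exact_mod_cast huv
    have hmk' : (m : ℝ) + 1 ≤ k := by exact_mod_cast hmk
    obtain ⟨t'', ht'', hh⟩ := hsub (show (m : ℝ) + 1 / 2 ∈ Set.Icc (m : ℝ) k from
      ⟨by linarith, by linarith⟩)
    obtain ⟨l, hl⟩ := hint t'' ht''
    simp only [hl] at hh
    have h1 : (m : ℝ) < l := by linarith
    have h2 : (l : ℝ) < m + 1 := by linarith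
    have h1' : m < l := by exact_mod_cast h1
    have h2' : l < m + 1 := by exact_mod_cast h2
    omega
  rcases lt_or_gt_of_ne hne with hlt | hlt
  · exact key _ _ ⟨b, hb, rfl⟩ ⟨a, ha, rfl⟩ hlt
  · exact key _ _ ⟨a, ha, rfl⟩ ⟨b, hb, rfl⟩ hlt

theorem continuous_flow_curve (p : MappingTorus M) : Continuous fun t => flow t p := by
  obtain ⟨x, s, rfl⟩ := torusMk_surjective p
  exact continuous_torusMk_comp continuous_const (continuous_const.add continuous_id)

/-- A homeomorphism of the mapping torus that is increasing on some segment of every orbit preserves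
the orientation of orbits. -/
theorem isOrientationPreserving_of_increasing (h : MappingTorus M ≃ₜ MappingTorus M)
    (hinc : ∀ x : VertexShift M, ∃ (y : VertexShift M) (a b : ℝ) (τ : ℝ → ℝ), a < b ∧
      ContinuousOn τ (Set.Icc a b) ∧ τ a < τ b ∧
      ∀ s ∈ Set.Icc a b, h (torusMk x s) = torusMk y (τ s)) :
    IsOrientationPreserving h := by
  intro p
  obtain ⟨x, s₀, rfl⟩ := torusMk_surjective p
  obtain ⟨y, θ, hθ, hy⟩ := exists_lift_curve (h.continuous.comp (continuous_flow_curve (torusMk x s₀)))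
  obtain ⟨z, η, hη, hz⟩ := exists_lift_curve (h.symm.continuous.comp
    (continuous_flow_curve (torusMk y 0)))
  simp only [Function.comp, flow_torusMk, zero_add] at hy hz
  have h1 : ∀ t, torusMk x (s₀ + t) = torusMk z (η (θ t)) := fun t => by
    rw [← hz, ← hy, h.symm_apply_apply]
  -- The lift `η` of the inverse may start on a different sheet than `s₀`; subtracting `η (θ 0)`
  -- corrects this, so that `θ` and the corrected `η` are mutually inverse.
  have h2 : ∀ t, torusMk y t = torusMk y (θ (η t - η (θ 0))) := fun t => by
    obtain ⟨m, rfl, hm⟩ := torusMk_eq_iff.1 (h1 0)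
    have := hz t
    rw [Homeomorph.symm_apply_eq] at this
    rw [← hy, this, torusMk_shift]
    congr 2
    linarith
  have h3 : ∀ t, η (θ t) - t = η (θ 0) := fun t => by
    have := sub_eq_const_of_torusMk_eq (S := Set.univ) isPreconnected_univ
      (continuous_const_add s₀).continuousOn (hη.comp hθ).continuousOn
      (fun t _ => h1 t) (Set.mem_univ 0) (Set.mem_univ t)
    simp only [Function.comp] at this
    linarith
  have h4 : ∀ t, θ (η t - η (θ 0)) = t := fun t => by
    have := sub_eq_const_of_torusMk_eq (S := Set.univ) isPreconnected_univ
      continuous_id.continuousOn (θ' := fun t => θ (η t - η (θ 0)))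
      (hθ.comp (hη.sub continuous_const)).continuousOn
      (fun t _ => h2 t) (Set.mem_univ (θ 0)) (Set.mem_univ t)
    simp only [id, sub_self] at this
    linarith
  have hinj : Function.Injective θ := fun a b hab => by
    have := h3 a; have := h3 b; rw [hab] at *; linarith
  have hmono : StrictMono θ := by
    rcases hθ.strictMono_of_inj hinj with hm | hm
    · exact hm
    -- A decreasing lift would differ by a constant from `τ` on the segment where the map is known
    -- to increase.
    · exfalso
      obtain ⟨y', a, b, τ, hab, hτ, hlt, hh⟩ := hinc x
      have := sub_eq_const_of_torusMk_eq (y := y) (y' := y') (θ := fun s => θ (s - s₀)) (θ' := τ)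
        (isPreconnected_Icc (a := a) (b := b))
        (hθ.comp (continuous_id.sub continuous_const)).continuousOn hτ
        (fun s hs => by rw [← hh s hs, ← hy]; congr 2; ring)
        (Set.left_mem_Icc.2 hab.le) (Set.right_mem_Icc.2 hab.le)
      have := hm (show a - s₀ < b - s₀ by linarith)
      linarith
  have hsurj : Function.Surjective θ := fun t => ⟨_, h4 t⟩
  let e := hmono.orderIsoOfSurjective θ hsurj
  refine ⟨e.trans (OrderIso.addRight (-(θ 0))), fun t => ?_⟩
  have h0 := hy 0
  rw [add_zero] at h0
  rw [flow_torusMk, hy, h0, flow_torusMk]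
  congr 1
  change θ t = θ 0 + (θ t + -θ 0)
  ring

/-- A homeomorphism that is isotopic to the identity preserves every flow orbit. -/
theorem exists_flow_of_mem_isotopicToId {h : OPHomeo M} (hh : h ∈ isotopicToId M)
    (x : VertexShift M) : ∃ t, h.1 (torusMk x 0) = torusMk x t := by
  obtain ⟨H, hH, h0, h1⟩ := hh
  -- The track of one point under the isotopy, extended constantly beyond the unit interval, is a
  -- curve and so stays in one orbit.
  obtain ⟨y, θ, -, hy⟩ := exists_lift_curve (γ := fun t =>
    (H (Set.projIcc 0 1 zero_le_one t)).1 (torusMk x 0))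
    (hH.comp (f := fun t => (Set.projIcc (0 : ℝ) 1 zero_le_one t, torusMk x 0))
      (continuous_projIcc.prodMk continuous_const))
  have e0 := hy 0
  have e1 := hy 1
  rw [Set.projIcc_left] at e0
  rw [Set.projIcc_right] at e1
  change (H 0).1 _ = _ at e0
  change (H 1).1 _ = _ at e1
  rw [h0] at e0
  rw [h1] at e1
  obtain ⟨m, rfl, -⟩ := torusMk_eq_iff.1 (show torusMk x 0 = torusMk y (θ 0) from e0)
  exact ⟨_, e1.trans (torusMk_shift _ _ _)⟩

/-- Maps that depend on finitely many cells only are locally constant. -/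
theorem VertexShift.isLocallyConstant_of_finite_dependence {α : Type*}
    {f : VertexShift M → α} (K : ℕ)
    (h : ∀ x x' : VertexShift M, (∀ i : ℤ, |i| ≤ K → x'.1 i = x.1 i) → f x' = f x) :
    IsLocallyConstant f := by
  refine (IsLocallyConstant.iff_eventually_eq f).2 fun x => ?_
  have : ∀ᶠ x' in 𝓝 x, ∀ i ∈ Finset.Icc (-(K : ℤ)) K, x'.1 i = x.1 i :=
    (Finset.eventually_all _).2 fun i _ =>
      (VertexShift.continuous_apply i).continuousAt.eventually
        (show ∀ᶠ a in 𝓝 (x.1 i), a = x.1 i by simp)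
  filter_upwards [this] with x' hx'
  exact h x x' fun i hi => hx' i (Finset.mem_Icc.2 (abs_le.1 hi))

theorem VertexShift.continuous_shift_of_isLocallyConstant {m : VertexShift M → ℤ}
    (hm : IsLocallyConstant m) : Continuous fun x : VertexShift M => x.shift (m x) := by
  refine continuous_iff_continuousAt.2 fun x => ?_
  refine (VertexShift.continuous_shift (m x)).continuousAt.congr ?_
  filter_upwards [(IsLocallyConstant.iff_eventually_eq m).1 hm x] with x' hx'
  rw [hx']

end TorusTopology

/-! ### Piecewise linear parametrizations of blocks -/

section Stretch

/-- The group of increasing piecewise linear homeomorphisms of the line, with locally finitely many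
breaks. -/
def piecewiseLinearIso : Subgroup (ℝ ≃o ℝ) where
  carrier := {f | ∀ c, ∃ ε > 0, ∃ a > 0, ∃ b > 0, ∀ s, 0 ≤ s → s < ε →
    f (c + s) = f c + b * s ∧ f (c - s) = f c - a * s}
  one_mem' c := ⟨1, one_pos, 1, one_pos, 1, one_pos, fun s _ _ => by simp⟩
  mul_mem' := by
    intro f g hf hg c
    obtain ⟨ε, hε, a, ha, b, hb, h⟩ := hg c
    obtain ⟨ε', hε', a', ha', b', hb', h'⟩ := hf (g c)
    refine ⟨min ε (min (ε' / a) (ε' / b)), by positivity, a' * a, by positivity, b' * b,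
      by positivity, fun s h0 hs => ?_⟩
    obtain ⟨h1, h2, h3⟩ : s < ε ∧ s < ε' / a ∧ s < ε' / b := by simpa using hs
    rw [lt_div_iff₀ ha] at h2
    rw [lt_div_iff₀ hb] at h3
    constructor
    · rw [RelIso.mul_apply, RelIso.mul_apply, (h s h0 h1).1,
        (h' (b * s) (by positivity) (by linarith)).1]
      ring
    · rw [RelIso.mul_apply, RelIso.mul_apply, (h s h0 h1).2,
        (h' (a * s) (by positivity) (by linarith)).2]
      ring
  inv_mem' := by
    intro f hf c
    obtain ⟨ε, hε, a, ha, b, hb, h⟩ := hf (f⁻¹ c)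
    refine ⟨min (ε * a) (ε * b), by positivity, a⁻¹, by positivity, b⁻¹, by positivity,
      fun s h0 hs => ?_⟩
    obtain ⟨h1, h2⟩ : s < ε * a ∧ s < ε * b := by simpa using hs
    have hc : f (f⁻¹ c) = c := RelIso.apply_inv_self f c
    constructor
    · have := (h (b⁻¹ * s) (by positivity) (by rw [inv_mul_lt_iff₀ hb]; linarith)).1
      rw [hc, mul_inv_cancel_left₀ hb.ne'] at this
      rw [← this, RelIso.inv_apply_self]
    · have := (h (a⁻¹ * s) (by positivity) (by rw [inv_mul_lt_iff₀ ha]; linarith)).2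
      rw [hc, mul_inv_cancel_left₀ ha.ne'] at this
      rw [← this, RelIso.inv_apply_self]

/-- The piecewise linear homeomorphism with slope `3 / 2` before `2` and a translation by `1`
after `2`. -/
noncomputable def pushRight : ℝ ≃o ℝ where
  toFun t := min (3 / 2 * t) (t + 1)
  invFun t := max (2 / 3 * t) (t - 1)
  left_inv t := by
    rcases le_total (3 / 2 * t) (t + 1) with h | h
    · simp only [min_eq_left h]; rw [max_eq_left (by linarith)]; ring
    · simp only [min_eq_right h]; rw [max_eq_right (by linarith)]; ring
  right_inv t := by
    rcases le_total (2 / 3 * t) (t - 1) with h | h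
    · simp only [max_eq_right h]; rw [min_eq_right (by linarith)]; ring
    · simp only [max_eq_left h]; rw [min_eq_left (by linarith)]; ring
  map_rel_iff' := by
    intro s t
    constructor
    · intro h
      change min (3 / 2 * s) (s + 1) ≤ min (3 / 2 * t) (t + 1) at h
      by_contra hlt
      push Not at hlt
      exact absurd h (not_le.2 (min_lt_min (by linarith) (by linarith)))
    · intro h
      change min (3 / 2 * s) (s + 1) ≤ min (3 / 2 * t) (t + 1)
      exact min_le_min (by linarith) (by linarith)

theorem pushRight_of_le {t : ℝ} (h : t ≤ 2) : pushRight t = 3 / 2 * t :=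
  min_eq_left (by linarith)

theorem pushRight_of_ge {t : ℝ} (h : 2 ≤ t) : pushRight t = t + 1 :=
  min_eq_right (by linarith)

theorem pushRight_mem : pushRight ∈ piecewiseLinearIso := by
  intro c
  rcases lt_trichotomy c 2 with h | rfl | h
  · refine ⟨2 - c, by linarith, 3 / 2, by norm_num, 3 / 2, by norm_num, fun s h0 hs => ?_⟩
    rw [pushRight_of_le (by linarith), pushRight_of_le (by linarith),
      pushRight_of_le (by linarith)]
    constructor <;> ring
  · refine ⟨1, by linarith, 3 / 2, by norm_num, 1, by norm_num, fun s h0 hs => ?_⟩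
    rw [pushRight_of_ge (by linarith), pushRight_of_le le_rfl, pushRight_of_le (by linarith)]
    constructor <;> ring
  · refine ⟨c - 2, by linarith, 1, by norm_num, 1, by norm_num, fun s h0 hs => ?_⟩
    rw [pushRight_of_ge (by linarith), pushRight_of_ge (by linarith),
      pushRight_of_ge (by linarith)]
    constructor <;> ring

/-- The reference parametrization of a block of length `m` by the unit interval. -/
noncomputable def stretch : ℕ → (ℝ ≃o ℝ)
  | 0 => 1
  | 1 => 1
  | 2 => OrderIso.mulLeft₀ 2 two_pos
  -- Each symbol beyond the second is inserted by `pushRight`, which keeps the later part of the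
  -- block rigid. Length `0` is a default value, as blocks are not empty.
  | m + 3 => pushRight * stretch (m + 2)

theorem stretch_mem : ∀ m, stretch m ∈ piecewiseLinearIso
  | 0 => one_mem _
  | 1 => one_mem _
  | 2 => fun c => ⟨1, one_pos, 2, two_pos, 2, two_pos, fun s _ _ => by
      simp only [stretch, OrderIso.mulLeft₀_apply]; constructor <;> ring⟩
  | m + 3 => mul_mem pushRight_mem (stretch_mem (m + 2))

theorem stretch_zero : ∀ m, stretch m 0 = 0
  | 0 => rfl
  | 1 => rfl
  | 2 => mul_zero _
  | m + 3 => by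
    rw [stretch, RelIso.mul_apply, stretch_zero (m + 2), pushRight_of_le (by norm_num), mul_zero]

theorem stretch_one : ∀ m, 1 ≤ m → stretch m 1 = m
  | 1, _ => by simp [stretch]
  | 2, _ => by simp [stretch]
  | m + 3, _ => by
    rw [stretch, RelIso.mul_apply, stretch_one (m + 2) (by omega),
      pushRight_of_ge (by push_cast; linarith [(Nat.cast_nonneg m : (0 : ℝ) ≤ m)])]
    push_cast
    ring

theorem stretch_add_two (k : ℕ) : stretch (k + 2) = pushRight ^ k * stretch 2 := by
  induction k with
  | zero => rw [pow_zero, one_mul]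
  | succ k ih => rw [pow_succ', mul_assoc, ← ih]; rfl

theorem pushRight_pow_of_ge (k : ℕ) {t : ℝ} (h : 2 ≤ t) : (pushRight ^ k) t = t + k := by
  induction k with
  | zero => simp
  | succ k ih =>
    rw [pow_succ', RelIso.mul_apply, ih, pushRight_of_ge]
    · push_cast; ring
    · linarith [(Nat.cast_nonneg k : (0 : ℝ) ≤ k)]

/-- The standard map from a block of length `m` to a block of length `m'`. -/
noncomputable def restretch (m m' : ℕ) : ℝ ≃o ℝ := stretch m' * (stretch m)⁻¹

theorem restretch_mem (m m' : ℕ) : restretch m m' ∈ piecewiseLinearIso :=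
  mul_mem (stretch_mem m') (inv_mem (stretch_mem m))

theorem restretch_self (m : ℕ) : restretch m m = 1 := mul_inv_cancel _

/-- The parametrization of the intermediate block cancels. This identity makes the action of `V`
strict. -/
theorem restretch_trans (m m' m'' : ℕ) (t : ℝ) :
    restretch m' m'' (restretch m m' t) = restretch m m'' t := by
  simp only [restretch, RelIso.mul_apply, RelIso.inv_apply_self]

theorem restretch_stretch (m m' : ℕ) (t : ℝ) : restretch m m' (stretch m t) = stretch m' t := by
  rw [restretch, RelIso.mul_apply, RelIso.inv_apply_self]

theorem restretch_zero (m m' : ℕ) : restretch m m' 0 = 0 := by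
  conv_lhs => rw [← stretch_zero m]
  rw [restretch_stretch, stretch_zero]

theorem restretch_right {m m' : ℕ} (hm : 1 ≤ m) (hm' : 1 ≤ m') : restretch m m' m = m' := by
  conv_lhs => rw [← stretch_one m hm]
  rw [restretch_stretch, stretch_one m' hm']

theorem restretch_add_two (k l : ℕ) :
    restretch (k + 2) (l + 2) = pushRight ^ l * (pushRight ^ k)⁻¹ := by
  rw [restretch, stretch_add_two l, stretch_add_two k]
  group

/-- Both sides are products of powers of `pushRight`, and the additional `pushRight ^ j` cancels.
Thus a common tail of two blocks has no influence on the map, which is why the action on blocks is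
local. -/
theorem restretch_add {m m' : ℕ} (hm : 2 ≤ m) (hm' : 2 ≤ m') (j : ℕ) :
    restretch (m + j) (m' + j) = restretch m m' := by
  obtain ⟨k, rfl⟩ := Nat.exists_eq_add_of_le' hm
  obtain ⟨l, rfl⟩ := Nat.exists_eq_add_of_le' hm'
  rw [add_right_comm k, add_right_comm l, restretch_add_two, restretch_add_two, pow_add, pow_add]
  group

/-- Beyond `2` every power of `pushRight` is a translation, so the tail of a block is copied without
distortion. -/
theorem restretch_of_ge {m m' : ℕ} (hm : 2 ≤ m) (hm' : 2 ≤ m') {t : ℝ} (ht : m ≤ t) :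
    restretch m m' t = t - m + m' := by
  obtain ⟨k, rfl⟩ := Nat.exists_eq_add_of_le' hm
  obtain ⟨l, rfl⟩ := Nat.exists_eq_add_of_le' hm'
  push_cast at ht ⊢
  have h : t = (pushRight ^ k) (t - k) := by
    rw [pushRight_pow_of_ge k (by linarith)]; ring
  rw [restretch_add_two, RelIso.mul_apply]
  conv_lhs => rw [h]
  rw [RelIso.inv_apply_self, pushRight_pow_of_ge l (by linarith)]
  ring

/-- For `m = 3` the doubled unit interval is exactly the part where `pushRight` has slope `3 / 2`,
and `3 / 2 * 2 = 3`. For larger `m` linearity fails. -/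
theorem stretch_of_mem_Icc {m : ℕ} (h1 : 1 ≤ m) (h3 : m ≤ 3) {s : ℝ} (hs : s ∈ Set.Icc (0 : ℝ) 1) :
    stretch m s = s * m := by
  interval_cases m
  · simp [stretch]
  · simp [stretch, mul_comm]
  · rw [stretch, RelIso.mul_apply]
    simp only [stretch, OrderIso.mulLeft₀_apply]
    rw [pushRight_of_le (by linarith [hs.2])]
    push_cast
    ring

theorem restretch_mul_of_le_three {m m' : ℕ} (h1 : 1 ≤ m) (h3 : m ≤ 3) (h1' : 1 ≤ m')
    (h3' : m' ≤ 3) {s : ℝ} (hs : s ∈ Set.Icc (0 : ℝ) 1) :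
    restretch m m' (s * m) = s * m' := by
  rw [← stretch_of_mem_Icc h1 h3 hs, restretch_stretch, stretch_of_mem_Icc h1' h3' hs]

theorem restretch_three_four : restretch 3 4 = pushRight := by
  rw [restretch_add_two 1 2]; group

end Stretch

/-! ### Block codes and the maps of the mapping torus that they induce -/

/-- The mapping torus is a quotient of the product of the vertex shift and the unit interval. -/
theorem isQuotientMap_torusMk_unit {n : ℕ} {M : Matrix (Fin n) (Fin n) ℕ} :
    IsQuotientMap fun p : VertexShift M × Set.Icc (0 : ℝ) 1 => torusMk p.1 (p.2 : ℝ) := by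
  have hq : Continuous fun p : VertexShift M × Set.Icc (0 : ℝ) 1 => torusMk p.1 (p.2 : ℝ) :=
    continuous_torusMk_comp continuous_fst (continuous_subtype_val.comp continuous_snd)
  -- The source is compact and the target Hausdorff, so the map is closed.
  refine hq.isClosedMap.isQuotientMap hq fun p => ?_
  obtain ⟨x, t, rfl⟩ := torusMk_surjective p
  refine ⟨(x.shift ⌊t⌋, ⟨Int.fract t, Int.fract_nonneg t, (Int.fract_lt_one t).le⟩), ?_⟩
  change torusMk _ _ = _
  rw [torusMk_shift, Int.fract_add_floor]

/-- A division of all configurations into finite pieces, each of which is to be replaced by a word: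
`start x` is the distance from cell `0` back to the beginning of its piece, and if a piece begins at
cell `0` then `len x` is its length and `out x` the word that replaces it. -/
structure BlockCode {n : ℕ} (M : Matrix (Fin n) (Fin n) ℕ) where
  start : VertexShift M → ℕ
  len : VertexShift M → ℕ
  out : VertexShift M → List (Fin n)
  isLocallyConstant_start : IsLocallyConstant start
  isLocallyConstant_len : IsLocallyConstant len
  isLocallyConstant_out : IsLocallyConstant out
  -- Required for all configurations, even if no piece begins at cell `0`, so that the recursion in
  -- `word` terminates without a side condition.
  out_length_pos : ∀ x, 0 < (out x).length
  start_base : ∀ x : VertexShift M, start (x.shift (-start x)) = 0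
  start_lt : ∀ x : VertexShift M, start x < len (x.shift (-start x))
  start_shift : ∀ (x : VertexShift M) (k : ℕ), start x = 0 → k < len x → start (x.shift k) = k
  start_next : ∀ x : VertexShift M, start x = 0 → start (x.shift (len x)) = 0
  out_adj : ∀ x (i : ℕ) (h : i + 1 < (out x).length), M (out x)[i] (out x)[i + 1] = 1
  out_junction : ∀ x : VertexShift M, start x = 0 →
    M ((out x)[(out x).length - 1]'(Nat.sub_lt (out_length_pos x) one_pos))
      ((out (x.shift (len x)))[0]'(out_length_pos _)) = 1

namespace BlockCode

variable {n : ℕ} {M : Matrix (Fin n) (Fin n) ℕ} (C : BlockCode M)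

/-- The configuration that begins with the piece containing cell `0`. -/
def base (x : VertexShift M) : VertexShift M := x.shift (-C.start x)

/-- The configuration that begins with the piece after the one at cell `0`. -/
def next (x : VertexShift M) : VertexShift M := x.shift (C.len x)

/-- The configuration that begins with the piece before the one at cell `0`. -/
def prev (x : VertexShift M) : VertexShift M := C.base (x.shift (-1))

theorem start_base' (x : VertexShift M) : C.start (C.base x) = 0 := C.start_base x

theorem len_pos {x : VertexShift M} (hx : C.start x = 0) : 0 < C.len x := by
  have := C.start_lt x
  rwa [hx, Nat.cast_zero, neg_zero, x.shift_zero] at this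

theorem base_of_start_eq_zero {x : VertexShift M} (hx : C.start x = 0) : C.base x = x := by
  rw [base, hx, Nat.cast_zero, neg_zero, x.shift_zero]

theorem base_shift {x : VertexShift M} (hx : C.start x = 0) {k : ℕ} (hk : k < C.len x) :
    C.base (x.shift k) = x := by
  rw [base, C.start_shift x k hx hk, VertexShift.shift_shift, neg_add_cancel, x.shift_zero]

theorem shift_base (x : VertexShift M) : (C.base x).shift (C.start x) = x := by
  rw [base, VertexShift.shift_shift, add_neg_cancel, x.shift_zero]

theorem prev_next {x : VertexShift M} (hx : C.start x = 0) : C.prev (C.next x) = x := by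
  have h := C.len_pos hx
  rw [prev, next, VertexShift.shift_shift,
    show (-1 + C.len x : ℤ) = ((C.len x - 1 : ℕ) : ℤ) by omega]
  exact C.base_shift hx (by omega)

theorem next_prev {x : VertexShift M} (hx : C.start x = 0) : C.next (C.prev x) = x := by
  set w := x.shift (-1) with hw
  have h0 : C.start (C.base w) = 0 := C.start_base w
  have h1 : C.start w < C.len (C.base w) := C.start_lt w
  have h2 : (C.base w).shift ((C.start w + 1 : ℕ) : ℤ) = x := by
    rw [base, VertexShift.shift_shift, hw, VertexShift.shift_shift]
    convert x.shift_zero using 2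
    push_cast
    ring
  -- The piece containing cell `-1` ends there: otherwise cell `0` would lie in its interior,
  -- against `C.start x = 0`.
  have h3 : C.len (C.base w) = C.start w + 1 := by
    by_contra hne
    have := C.start_shift _ _ h0 (show C.start w + 1 < C.len (C.base w) by omega)
    rw [h2, hx] at this
    omega
  rw [prev, ← hw, next, h3, h2]

theorem isLocallyConstant_neg_start : IsLocallyConstant fun x => -(C.start x : ℤ) :=
  C.isLocallyConstant_start.comp fun k : ℕ => -(k : ℤ)

theorem continuous_base : Continuous C.base :=
  VertexShift.continuous_shift_of_isLocallyConstant C.isLocallyConstant_neg_start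

theorem continuous_next : Continuous C.next :=
  VertexShift.continuous_shift_of_isLocallyConstant
    (C.isLocallyConstant_len.comp fun k : ℕ => (k : ℤ))

theorem continuous_prev : Continuous C.prev :=
  C.continuous_base.comp (VertexShift.continuous_shift _)

/-- The concatenation of the words that replace the pieces of `x`, if a piece begins at
cell `0`. -/
def word (x : VertexShift M) (k : ℤ) : Fin n :=
  if h0 : 0 ≤ k then
    if h : k.toNat < (C.out x).length then (C.out x)[k.toNat]
    else word (C.next x) (k - (C.out x).length)
  else word (C.prev x) (k + (C.out (C.prev x)).length)
-- A negative index increases until it is nonnegative, and a nonnegative one decreases but never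
-- becomes negative again; the first component records this single change of phase.
termination_by (if 0 ≤ k then 0 else 1, k.natAbs)
decreasing_by
  · have := C.out_length_pos x
    rw [if_pos h0, if_pos (by omega)]
    exact Prod.Lex.right _ (by omega)
  · have := C.out_length_pos (C.prev x)
    rw [if_neg h0]
    split_ifs
    · exact Prod.Lex.left _ _ one_pos
    · exact Prod.Lex.right _ (by omega)

theorem word_of_lt (x : VertexShift M) {k : ℕ} (h : k < (C.out x).length) :
    C.word x k = (C.out x)[k] := by
  rw [word, dif_pos (by omega), dif_pos (by simpa using h)]
  simp

/-- For `0 ≤ k` the recursion unfolds on the right-hand side, for negative `k` on the left-hand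
side, where it returns to `x` by `prev_next`. -/
theorem word_next {x : VertexShift M} (hx : C.start x = 0) (k : ℤ) :
    C.word (C.next x) k = C.word x (k + (C.out x).length) := by
  by_cases h : 0 ≤ k
  · conv_rhs => rw [word]
    rw [dif_pos (by omega), dif_neg (by omega), add_sub_cancel_right]
  · conv_lhs => rw [word]
    rw [dif_neg h, C.prev_next hx]

theorem word_prev {x : VertexShift M} (hx : C.start x = 0) (k : ℤ) :
    C.word x k = C.word (C.prev x) (k + (C.out (C.prev x)).length) := by
  have := C.word_next (x := C.prev x) (C.start_base _) k
  rwa [C.next_prev hx] at this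

/-- Every cell of the image is reached from a cell of the first word by passing to neighboring
pieces. -/
theorem word_induction {P : VertexShift M → ℤ → Prop}
    (h0 : ∀ x (k : ℕ), C.start x = 0 → k < (C.out x).length → P x k)
    (h1 : ∀ x k, C.start x = 0 → P (C.next x) k → P x (k + (C.out x).length))
    (h2 : ∀ x k, C.start x = 0 → P (C.prev x) (k + (C.out (C.prev x)).length) → P x k)
    (x : VertexShift M) (hx : C.start x = 0) (k : ℤ) : P x k := by
  induction x, k using BlockCode.word.induct C with
  | case1 x k hk h =>
    have := h0 x k.toNat hx h
    rwa [Int.toNat_of_nonneg hk] at this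
  | case2 x k hk h ih =>
    have := h1 x _ hx (ih (C.start_next x hx))
    rwa [sub_add_cancel] at this
  | case3 x k hk ih => exact h2 x k hx (ih (C.start_base _))

theorem word_adj (x : VertexShift M) (hx : C.start x = 0) (k : ℤ) :
    M (C.word x k) (C.word x (k + 1)) = 1 := by
  refine C.word_induction (P := fun x k => M (C.word x k) (C.word x (k + 1)) = 1)
    ?_ ?_ ?_ x hx k
  · intro x k hx hk
    rw [C.word_of_lt x hk]
    by_cases h : k + 1 < (C.out x).length
    · have := C.word_of_lt x h
      push_cast at this
      rw [this]
      exact C.out_adj x k h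
    -- At the last symbol of a word the neighbor is the first symbol of the next word.
    · have h' : ((k : ℤ) + 1) = ((0 : ℕ) : ℤ) + (C.out x).length := by omega
      rw [h', ← C.word_next hx, C.word_of_lt _ (C.out_length_pos _)]
      have := C.out_junction x hx
      have hk' : k = (C.out x).length - 1 := by omega
      simp only [hk']
      exact this
  · intro x k hx h
    rw [C.word_next hx, C.word_next hx] at h
    rwa [add_right_comm]
  · intro x k hx h
    rw [C.word_prev hx, C.word_prev hx (k + 1)]
    rwa [add_right_comm k 1]

/-- The recursion reaches a given index after finitely many pieces, and each step uses locally
constant data only. -/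
theorem isLocallyConstant_word (k : ℤ) : IsLocallyConstant fun x => C.word x k := by
  refine (IsLocallyConstant.iff_eventually_eq _).2 fun x => ?_
  have key : ∀ y : VertexShift M, ∀ᶠ y' in 𝓝 y, C.out y' = C.out y :=
    (IsLocallyConstant.iff_eventually_eq _).1 C.isLocallyConstant_out
  induction x, k using BlockCode.word.induct C with
  | case1 x k hk h =>
    filter_upwards [key x] with y hy
    rw [word.eq_def C y k, word.eq_def C x k]
    simp only [hk, hy, h, dif_pos]
  | case2 x k hk h ih =>
    filter_upwards [key x, C.continuous_next.continuousAt.eventually ih] with y hy hy'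
    rw [word.eq_def C y k, word.eq_def C x k]
    simp only [hk, hy, h, dif_pos, dif_neg, not_false_eq_true]
    exact hy'
  | case3 x k hk ih =>
    filter_upwards [C.continuous_prev.continuousAt.eventually (key (C.prev x)),
      C.continuous_prev.continuousAt.eventually ih] with y hy hy'
    rw [word.eq_def C y k, word.eq_def C x k]
    simp only [hk, hy, dif_neg, not_false_eq_true]
    exact hy'

/-- The image of a configuration, such that the word that replaces the piece containing cell `0`
begins at cell `0`. -/
def image (x : VertexShift M) : VertexShift M :=
  ⟨C.word (C.base x), C.word_adj _ (C.start_base x)⟩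

theorem continuous_image : Continuous C.image :=
  VertexShift.continuous_mk fun i =>
    ((C.isLocallyConstant_word i).continuous).comp C.continuous_base

theorem image_of_start_eq_zero {x : VertexShift M} (hx : C.start x = 0) :
    (C.image x).1 = C.word x := by
  change C.word (C.base x) = C.word x
  rw [C.base_of_start_eq_zero hx]

theorem image_shift {x : VertexShift M} (hx : C.start x = 0) {k : ℕ} (hk : k < C.len x) :
    C.image (x.shift k) = C.image x := by
  rw [image, image]
  congr 2
  rw [C.base_shift hx hk, C.base_of_start_eq_zero hx]

theorem image_next {x : VertexShift M} (hx : C.start x = 0) :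
    C.image (x.shift (C.len x)) = (C.image x).shift (C.out x).length := by
  refine Subtype.ext (funext fun k => ?_)
  rw [C.image_of_start_eq_zero (C.start_next x hx), VertexShift.shift_apply,
    C.image_of_start_eq_zero hx]
  exact C.word_next hx k

/-- The map from the cell at `0` to the line with origin at the beginning of the image piece. -/
noncomputable def cellMap (x : VertexShift M) (s : ℝ) : ℝ :=
  restretch (C.len (C.base x)) (C.out (C.base x)).length (C.start x + s)

/-- The formulas on adjacent cells fit together. Inside a piece they are the same formula; at its
end both describe the origin of the next word, since `restretch` maps right end to right end. -/
theorem torusMk_cellMap_one (x : VertexShift M) :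
    torusMk (C.image x) (C.cellMap x 1) = torusMk (C.image (x.shift 1)) (C.cellMap (x.shift 1) 0) := by
  have hb := C.start_base' x
  have hlt : C.start x < C.len (C.base x) := C.start_lt x
  have hx := C.shift_base x
  generalize C.start x = k at *
  have hk : ((C.base x).shift k).shift 1 = (C.base x).shift ((k + 1 : ℕ) : ℤ) := by
    rw [VertexShift.shift_shift, Nat.cast_add, Nat.cast_one, add_comm]
  rw [← hx, hk]
  generalize C.base x = b at *
  have hc : C.cellMap (b.shift k) 1 = restretch (C.len b) (C.out b).length (k + 1) := by
    rw [cellMap, C.start_shift b k hb hlt, C.base_shift hb hlt]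
  rw [hc, C.image_shift hb hlt]
  rcases (Nat.succ_le_of_lt hlt).lt_or_eq with h | h
  · rw [C.image_shift hb h, cellMap, C.base_shift hb h, C.start_shift b _ hb h]
    push_cast
    rw [add_zero]
  · rw [Nat.succ_eq_add_one] at h
    have h0 := C.start_next b hb
    rw [h, C.image_next hb, torusMk_shift, cellMap, h0, Nat.cast_zero, zero_add, restretch_zero,
      zero_add, ← Nat.cast_succ, Nat.succ_eq_add_one, h,
      restretch_right (C.len_pos hb) (C.out_length_pos b)]
    rfl

/-- The map of the mapping torus that replaces every piece by its word. -/
noncomputable def map : MappingTorus M → MappingTorus M :=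
  Quotient.lift (s := torusSetoid M) (fun p => torusMk (C.image (p.1.shift ⌊p.2⌋))
    (C.cellMap (p.1.shift ⌊p.2⌋) (Int.fract p.2))) (by
    rintro ⟨x, t⟩ ⟨y, s⟩ ⟨m, h, h'⟩
    dsimp only at h h'
    subst h h'
    simp only [VertexShift.shift_shift, Int.floor_add_intCast, Int.fract_add_intCast])

theorem map_cell (x : VertexShift M) {s : ℝ} (hs : s ∈ Set.Icc (0 : ℝ) 1) :
    C.map (torusMk x s) = torusMk (C.image x) (C.cellMap x s) := by
  change torusMk (C.image (x.shift ⌊s⌋)) (C.cellMap (x.shift ⌊s⌋) (Int.fract s)) = _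
  rcases hs.2.lt_or_eq with h | rfl
  · have h0 : ⌊s⌋ = 0 := Int.floor_eq_zero_iff.2 ⟨hs.1, h⟩
    have h1 : Int.fract s = s := Int.fract_eq_self.2 ⟨hs.1, h⟩
    rw [h0, h1, x.shift_zero]
  · rw [Int.floor_one, Int.fract_one, ← C.torusMk_cellMap_one]

theorem map_piece {x : VertexShift M} (hx : C.start x = 0) {s : ℝ}
    (hs : s ∈ Set.Icc (0 : ℝ) (C.len x)) :
    C.map (torusMk x s) = torusMk (C.image x) (restretch (C.len x) (C.out x).length s) := by
  -- The cell containing `s`; the right end of the piece is counted to its last cell.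
  obtain ⟨k, hk, h0, h1⟩ : ∃ k : ℕ, k < C.len x ∧ (k : ℝ) ≤ s ∧ s ≤ k + 1 := by
    rcases hs.2.lt_or_eq with h | rfl
    · exact ⟨⌊s⌋₊, (Nat.floor_lt hs.1).2 h, Nat.floor_le hs.1, (Nat.lt_floor_add_one s).le⟩
    · have := C.len_pos hx
      refine ⟨C.len x - 1, by omega, ?_, ?_⟩ <;> rw [Nat.cast_sub this] <;> push_cast <;> linarith
  have h : torusMk x s = torusMk (x.shift k) (s - k) := by
    rw [torusMk_shift]; congr 1; push_cast; ring
  rw [h, C.map_cell _ ⟨by linarith, by linarith⟩, C.image_shift hx hk, cellMap,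
    C.base_shift hx hk, C.start_shift x k hx hk, add_sub_cancel]

/-- Near a given configuration the lengths and the position in the piece are constant, so only the
real variable varies. -/
theorem continuous_cellMap :
    Continuous (Function.uncurry C.cellMap) := by
  refine continuous_iff_continuousAt.2 fun ⟨x, s⟩ => ?_
  have h : ∀ᶠ p : VertexShift M × ℝ in 𝓝 (x, s), restretch (C.len (C.base x))
      (C.out (C.base x)).length (C.start x + p.2) = Function.uncurry C.cellMap p := by
    have h1 := (C.continuous_base.comp (continuous_fst (Y := ℝ))).continuousAt (x := (x, s))
      |>.eventually ((IsLocallyConstant.iff_eventually_eq _).1 C.isLocallyConstant_len (C.base x))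
    have h2 := (C.continuous_base.comp (continuous_fst (Y := ℝ))).continuousAt (x := (x, s))
      |>.eventually ((IsLocallyConstant.iff_eventually_eq _).1 C.isLocallyConstant_out (C.base x))
    have h3 := (continuous_fst (Y := ℝ)).continuousAt (x := (x, s))
      |>.eventually ((IsLocallyConstant.iff_eventually_eq _).1 C.isLocallyConstant_start x)
    filter_upwards [h1, h2, h3] with p h1 h2 h3
    simp only [Function.comp] at h1 h2
    rw [Function.uncurry, cellMap, h1, h2, h3]
  refine ContinuousAt.congr ?_ h
  exact ((restretch _ _).continuous.comp (continuous_const.add continuous_snd)).continuousAt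

theorem continuous_map : Continuous C.map := by
  refine isQuotientMap_torusMk_unit.continuous_iff.2 ?_
  have h : (C.map ∘ fun p : VertexShift M × Set.Icc (0 : ℝ) 1 => torusMk p.1 (p.2 : ℝ)) =
      fun p => torusMk (C.image p.1) (C.cellMap p.1 p.2) :=
    funext fun p => C.map_cell p.1 p.2.2
  rw [h]
  have h' : Continuous fun p : VertexShift M × Set.Icc (0 : ℝ) 1 => (p.1, (p.2 : ℝ)) :=
    continuous_fst.prodMk (continuous_subtype_val.comp continuous_snd)
  have h₁ : Continuous fun p : VertexShift M × Set.Icc (0 : ℝ) 1 => C.image p.1 :=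
    C.continuous_image.comp continuous_fst
  have h₂ : (fun p : VertexShift M × Set.Icc (0 : ℝ) 1 => C.cellMap p.1 p.2) =
      Function.uncurry C.cellMap ∘ fun p => (p.1, (p.2 : ℝ)) := funext fun p => rfl
  refine continuous_torusMk_comp h₁ ?_
  rw [h₂]
  exact C.continuous_cellMap.comp h'

/-- Near every point, the map is a product of a map of configurations and a piecewise linear map. -/
theorem map_piecewiseLinear (x : VertexShift M) (t : ℝ) :
    ∃ U ∈ 𝓝 x, ∃ ε > (0 : ℝ), ∃ (k : VertexShift M → VertexShift M) (r slopeL slopeR : ℝ),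
      ∀ x' ∈ U, ∀ s : ℝ, 0 ≤ s → s < ε →
        C.map (torusMk x' (t + s)) = torusMk (k x') (r + slopeR * s) ∧
        C.map (torusMk x' (t - s)) = torusMk (k x') (r - slopeL * s) := by
  have hconst : ∀ i : ℤ, ∀ᶠ x' in 𝓝 x, ∀ s, C.cellMap (x'.shift i) s =
      restretch (C.len (C.base (x.shift i))) (C.out (C.base (x.shift i))).length
        (C.start (x.shift i) + s) := fun i => by
    have hc := VertexShift.continuous_shift (M := M) i
    have h1 := (C.continuous_base.comp hc).continuousAt (x := x)
      |>.eventually ((IsLocallyConstant.iff_eventually_eq _).1 C.isLocallyConstant_len _)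
    have h2 := (C.continuous_base.comp hc).continuousAt (x := x)
      |>.eventually ((IsLocallyConstant.iff_eventually_eq _).1 C.isLocallyConstant_out _)
    have h3 := hc.continuousAt (x := x)
      |>.eventually ((IsLocallyConstant.iff_eventually_eq _).1 C.isLocallyConstant_start _)
    filter_upwards [h1, h2, h3] with p h1 h2 h3 s
    simp only [Function.comp] at h1 h2
    rw [cellMap, h1, h2, h3]
  -- The cells to the right and to the left of `t`; they differ only if `t` is an integer.
  set i := ⌊t⌋
  set j := ⌈t⌉ - 1
  have hi0 : (i : ℝ) ≤ t := Int.floor_le t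
  have hi1 : t < i + 1 := Int.lt_floor_add_one t
  have hj0 : (j : ℝ) < t := by
    have := Int.ceil_lt_add_one t
    simp only [j]; push_cast; linarith
  have hj1 : t ≤ j + 1 := by
    have := Int.le_ceil t
    simp only [j]; push_cast; linarith
  have hcell : ∀ (x' : VertexShift M) (l : ℤ) (u : ℝ), (l : ℝ) ≤ u → u ≤ l + 1 →
      C.map (torusMk x' u) = torusMk (C.image (x'.shift l)) (C.cellMap (x'.shift l) (u - l)) := by
    intro x' l u h0 h1
    rw [← C.map_cell _ ⟨by linarith, by linarith⟩, torusMk_shift, sub_add_cancel]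
  obtain ⟨ε, hε, _, _, b, _, hR⟩ := restretch_mem (C.len (C.base (x.shift i)))
    (C.out (C.base (x.shift i))).length (C.start (x.shift i) + (t - i))
  obtain ⟨ε', hε', a, _, _, _, hL⟩ := restretch_mem (C.len (C.base (x.shift j)))
    (C.out (C.base (x.shift j))).length (C.start (x.shift j) + (t - j))
  refine ⟨_, (hconst i).and (hconst j), min (min ε ε') (min (i + 1 - t) (t - j)),
    lt_min (lt_min hε hε') (lt_min (by linarith) (by linarith)), fun x' => C.image (x'.shift i),
    restretch (C.len (C.base (x.shift i))) (C.out (C.base (x.shift i))).length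
      (C.start (x.shift i) + (t - i)), a, b, ?_⟩
  rintro x' ⟨hx'i, hx'j⟩ s h0 hs
  obtain ⟨⟨hs1, hs2⟩, hs3, hs4⟩ : (s < ε ∧ s < ε') ∧ s < i + 1 - t ∧ s < t - j := by
    simpa using hs
  dsimp only
  constructor
  · rw [hcell x' i (t + s) (by linarith) (by linarith), hx'i, ← (hR s h0 hs1).1]
    congr 2; ring
  -- Comparing both formulas at `t` itself determines the shift between the charts of the two cells,
  -- so that one map `k` serves both sides.
  · have h1 := hcell x' i t hi0 hi1.le
    have h2 := hcell x' j t hj0.le hj1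
    rw [hx'i] at h1
    rw [hx'j] at h2
    obtain ⟨m, hm, hm'⟩ := torusMk_eq_iff.1 (h2.symm.trans h1)
    rw [hcell x' j (t - s) (by linarith) (by linarith), hx'j, hm, torusMk_shift,
      show (C.start (x.shift j) + (t - s - j) : ℝ) = C.start (x.shift j) + (t - j) - s by ring,
      (hL s h0 hs2).2, hm']
    congr 1; ring

end BlockCode

/-! ### Coding of blocks by points of Cantor space -/

/-- The symbol of a binary digit. -/
def bitSymbol (b : Bool) : Fin 3 := if b then 1 else 0

theorem bitSymbol_ne_two (b : Bool) : bitSymbol b ≠ 2 := by cases b <;> decide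

theorem bitSymbol_decide {a : Fin 3} (h : a ≠ 2) : bitSymbol (decide (a = 1)) = a := by
  revert a; decide

theorem decide_bitSymbol (b : Bool) : decide (bitSymbol b = 1) = b := by cases b <;> decide

theorem matX_eq_one_iff (a b : Fin 3) : matX a b = 1 ↔ ¬ (a = 0 ∧ b = 2) := by
  fin_cases a <;> fin_cases b <;> simp [matX]

/-- The binary word read from cell `0` to the right, completed by zeros from the first symbol `2`
on. -/
def tailCode (x : VertexShift matX) : Cantor :=
  fun i => decide (x.1 i = 1 ∧ ∀ j ≤ i, x.1 j ≠ 2)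

/-- The point of Cantor space coded by the block that begins at cell `0`. -/
def blockCode (x : VertexShift matX) : Cantor := tailCode (x.shift 1)

theorem prepend_of_lt {u : List Bool} {z : Cantor} {i : ℕ} (h : i < u.length) :
    prepend u z i = u[i] := dif_pos h

theorem prepend_of_ge {u : List Bool} {z : Cantor} {i : ℕ} (h : u.length ≤ i) :
    prepend u z i = z (i - u.length) := dif_neg (not_lt.2 h)

theorem tailCode_append {x : VertexShift matX} {l : List Bool}
    (h : ∀ (i : ℕ) (hi : i < l.length), x.1 i = bitSymbol l[i]) :
    tailCode x = prepend l (tailCode (x.shift l.length)) := by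
  funext i
  rcases lt_or_ge i l.length with hi | hi
  · rw [prepend_of_lt hi]
    refine Eq.trans (decide_eq_decide.2 ?_) (decide_bitSymbol l[i])
    rw [h i hi]
    refine and_iff_left fun j hj => ?_
    rw [h j (by omega)]
    exact bitSymbol_ne_two _
  · rw [prepend_of_ge hi, tailCode, tailCode]
    simp only [VertexShift.shift_apply]
    refine decide_eq_decide.2 (and_congr ?_ ⟨fun H j hj => ?_, fun H j hj => ?_⟩)
    · rw [← Nat.cast_add, Nat.sub_add_cancel hi]
    · have := H (j + l.length) (by omega)
      rwa [Nat.cast_add] at this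
    · rcases lt_or_ge j l.length with hj' | hj'
      · rw [h j hj']; exact bitSymbol_ne_two _
      · have := H (j - l.length) (by omega)
        rwa [← Nat.cast_add, Nat.sub_add_cancel hj'] at this

theorem tailCode_of_two {x : VertexShift matX} {i k : ℕ} (h : x.1 k = 2) (hk : k ≤ i) :
    tailCode x i = false :=
  decide_eq_false fun H => H.2 k hk h

theorem tailCode_congr {x y : VertexShift matX} {k : ℕ} (hk : x.1 k = 2)
    (h : ∀ i : ℕ, i ≤ k → y.1 i = x.1 i) : tailCode y = tailCode x := by
  funext i
  rcases le_or_gt k i with hi | hi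
  · rw [tailCode_of_two hk hi, tailCode_of_two (h k le_rfl ▸ hk) hi]
  · refine decide_eq_decide.2 (and_congr (by rw [h i hi.le]) (forall₂_congr fun j hj => ?_))
    rw [h j (by omega)]

theorem bitSymbol_tailCode {x : VertexShift matX} {i : ℕ} (h : ∀ j ≤ i, x.1 j ≠ 2) :
    bitSymbol (tailCode x i) = x.1 i := by
  have : tailCode x i = decide (x.1 i = 1) := by
    exact decide_eq_decide.2 (and_iff_left h)
  rw [this, bitSymbol_decide (h i le_rfl)]

/-- Remove the trailing zeros of a word. -/
def trim (l : List Bool) : List Bool := l.rdropWhile (! ·)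

/-- Trailing zeros are absorbed by the vanishing tail. Hence a word can be trimmed before a symbol
`2`, to avoid `02`, without changing the coded point. -/
theorem prepend_trim (l : List Bool) :
    prepend (trim l) (fun _ => false) = prepend l fun _ => false := by
  induction l using List.reverseRecOn with
  | nil => rfl
  | append_singleton l b ih =>
    cases b
    · rw [trim, List.rdropWhile_concat_pos _ _ _ (by rfl), ← trim, ih, prepend_append]
      congr 1
      funext i
      rcases i with _ | i <;> simp [prepend]
    · rw [trim, List.rdropWhile_concat_neg _ _ _ (by simp)]

theorem getLast_trim (l : List Bool) (h : trim l ≠ []) : (trim l).getLast h = true := by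
  have := List.rdropWhile_last_not (fun b : Bool => ! b) l h
  rw [Bool.not_eq_true, Bool.not_eq_false'] at this
  exact this

/-! ### From tables of fixed depth to block codes -/

/-- A table for `g` that lists the values on all words of a fixed length. -/
structure UniformTable (g : Equiv.Perm Cantor) where
  depth : ℕ
  value : List Bool → List Bool
  -- With the symbol `2` included, this and `value_length_pos` make the initial pieces of long
  -- blocks and their images have length at least `2`, as `restretch_add` demands.
  depth_pos : 0 < depth
  apply_prepend : ∀ u, u.length = depth → ∀ z, g (prepend u z) = prepend (value u) z
  value_length_pos : ∀ u, u.length = depth → 0 < (value u).length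

namespace UniformTable

variable {g : Equiv.Perm Cantor} (T : UniformTable g)

open Classical in
/-- The distance from cell `0` back to the symbol `2` before it, if it is at most the depth of the
table; otherwise `0`. -/
noncomputable def start (x : VertexShift matX) : ℕ :=
  -- The value `0` in the other case is meaningful: cells farther than the depth from the preceding
  -- `2` are pieces of their own.
  if h : ∃ d : ℕ, d ≤ T.depth ∧ x.1 (-(d : ℤ)) = 2 then Nat.find h else 0

theorem start_eq {x : VertexShift matX} {d : ℕ} (hd : d ≤ T.depth) (h2 : x.1 (-(d : ℤ)) = 2)
    (h : ∀ e : ℕ, e < d → x.1 (-(e : ℤ)) ≠ 2) : T.start x = d := by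
  classical
  have hex : ∃ d : ℕ, d ≤ T.depth ∧ x.1 (-(d : ℤ)) = 2 := ⟨d, hd, h2⟩
  rw [start, dif_pos hex]
  exact (Nat.find_eq_iff hex).2 ⟨⟨hd, h2⟩, fun e he H => h e he H.2⟩

theorem start_eq_zero_of_far {x : VertexShift matX}
    (h : ∀ d : ℕ, d ≤ T.depth → x.1 (-(d : ℤ)) ≠ 2) : T.start x = 0 := by
  rw [start, dif_neg]
  rintro ⟨d, hd, h2⟩
  exact h d hd h2

theorem start_eq_zero_of_two {x : VertexShift matX} (h : x.1 0 = 2) : T.start x = 0 :=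
  T.start_eq (Nat.zero_le _) (by simpa using h) (by simp)

theorem start_cases (x : VertexShift matX) :
    (∃ d : ℕ, d ≤ T.depth ∧ x.1 (-(d : ℤ)) = 2 ∧ ∀ e : ℕ, e < d → x.1 (-(e : ℤ)) ≠ 2) ∨
      ∀ d : ℕ, d ≤ T.depth → x.1 (-(d : ℤ)) ≠ 2 := by
  classical
  by_cases hex : ∃ d : ℕ, d ≤ T.depth ∧ x.1 (-(d : ℤ)) = 2
  · refine Or.inl ⟨Nat.find hex, (Nat.find_spec hex).1, (Nat.find_spec hex).2, fun e he H => ?_⟩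
    exact Nat.find_min hex he ⟨he.le.trans (Nat.find_spec hex).1, H⟩
  · push Not at hex
    exact Or.inr hex

theorem eq_two_or_far_of_start_eq_zero {x : VertexShift matX} (h : T.start x = 0) :
    x.1 0 = 2 ∨ ∀ d : ℕ, d ≤ T.depth → x.1 (-(d : ℤ)) ≠ 2 := by
  rcases T.start_cases x with ⟨d, hd, h2, h'⟩ | h'
  · rw [T.start_eq hd h2 h'] at h
    subst h
    exact Or.inl (by simpa using h2)
  · exact Or.inr h'

open Classical in
/-- The length of the piece that begins with a symbol `2` at cell `0`. -/
noncomputable def span (x : VertexShift matX) : ℕ :=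
  Nat.find (p := fun m : ℕ => 0 < m ∧ (x.1 m = 2 ∨ m = T.depth + 1))
    ⟨T.depth + 1, Nat.succ_pos _, Or.inr rfl⟩

theorem span_eq {x : VertexShift matX} {m : ℕ} (h0 : 0 < m) (hm : m ≤ T.depth + 1)
    (h2 : x.1 m = 2 ∨ m = T.depth + 1) (h : ∀ i : ℕ, 0 < i → i < m → x.1 i ≠ 2) :
    T.span x = m := by
  classical
  refine (Nat.find_eq_iff _).2 ⟨⟨h0, h2⟩, fun i hi H => ?_⟩
  rcases H with ⟨H0, H | rfl⟩
  · exact h i H0 hi H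
  · omega

theorem span_spec (x : VertexShift matX) : 0 < T.span x ∧ T.span x ≤ T.depth + 1 ∧
    (x.1 (T.span x) = 2 ∨ T.span x = T.depth + 1) ∧
    ∀ i : ℕ, 0 < i → i < T.span x → x.1 i ≠ 2 := by
  classical
  have hex : ∃ m : ℕ, 0 < m ∧ (x.1 m = 2 ∨ m = T.depth + 1) :=
    ⟨T.depth + 1, Nat.succ_pos _, Or.inr rfl⟩
  exact ⟨(Nat.find_spec hex).1, Nat.find_min' hex ⟨Nat.succ_pos _, Or.inr rfl⟩,
    (Nat.find_spec hex).2, fun i h0 hi H => Nat.find_min hex hi ⟨h0, Or.inl H⟩⟩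

/-- The length of the piece that begins at cell `0`. -/
noncomputable def len (x : VertexShift matX) : ℕ := if x.1 0 = 2 then T.span x else 1

/-- The first digits of the block that begins at cell `0`, completed by zeros. -/
def read (x : VertexShift matX) : List Bool := List.ofFn fun i : Fin T.depth => blockCode x i

theorem length_read (x : VertexShift matX) : (T.read x).length = T.depth := List.length_ofFn

/-- The binary word that follows the symbol `2` at the beginning of the image of a piece. -/
noncomputable def outBits (x : VertexShift matX) : List Bool :=
  -- Trailing zeros are dropped only if the block ends here; otherwise further digits follow and the
  -- zeros are significant.
  if x.1 (T.span x) = 2 then trim (T.value (T.read x)) else T.value (T.read x)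

/-- The word that replaces the piece that begins at cell `0`. -/
noncomputable def out (x : VertexShift matX) : List (Fin 3) :=
  if x.1 0 = 2 then 2 :: (T.outBits x).map bitSymbol else [x.1 0]

theorem out_length_pos (x : VertexShift matX) : 0 < (T.out x).length := by
  rw [out]; split_ifs <;> simp

theorem out_head (x : VertexShift matX) : (T.out x)[0]'(T.out_length_pos x) = x.1 0 := by
  simp only [out]
  split_ifs with h
  · simp [h]
  · simp

theorem out_of_two {x : VertexShift matX} (h : x.1 0 = 2) :
    T.out x = 2 :: (T.outBits x).map bitSymbol := if_pos h

theorem out_of_ne_two {x : VertexShift matX} (h : x.1 0 ≠ 2) : T.out x = [x.1 0] := if_neg h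

theorem len_of_two {x : VertexShift matX} (h : x.1 0 = 2) : T.len x = T.span x := if_pos h

theorem len_of_ne_two {x : VertexShift matX} (h : x.1 0 ≠ 2) : T.len x = 1 := if_neg h

theorem start_congr {x x' : VertexShift matX} (h : ∀ i : ℤ, |i| ≤ (T.depth + 1 : ℕ) → x'.1 i = x.1 i) :
    T.start x' = T.start x := by
  have h' : ∀ d : ℕ, d ≤ T.depth → x'.1 (-(d : ℤ)) = x.1 (-(d : ℤ)) := fun d hd =>
    h _ (by rw [abs_neg, Nat.abs_cast]; omega)
  rcases T.start_cases x with ⟨d, hd, h2, H⟩ | H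
  · rw [T.start_eq hd h2 H, T.start_eq hd (by rw [h' d hd, h2])]
    intro e he
    rw [h' e (by omega)]
    exact H e he
  · rw [T.start_eq_zero_of_far H, T.start_eq_zero_of_far]
    intro d hd
    rw [h' d hd]
    exact H d hd

theorem span_congr {x x' : VertexShift matX} (h : ∀ i : ℤ, |i| ≤ (T.depth + 1 : ℕ) → x'.1 i = x.1 i) :
    T.span x' = T.span x := by
  have h' : ∀ d : ℕ, d ≤ T.depth + 1 → x'.1 d = x.1 d := fun d hd =>
    h _ (by rw [Nat.abs_cast]; omega)
  obtain ⟨h0, h1, h2, h3⟩ := T.span_spec x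
  refine T.span_eq h0 h1 (by rwa [h' _ h1]) fun i hi0 hi => ?_
  rw [h' i (by omega)]
  exact h3 i hi0 hi

theorem len_congr {x x' : VertexShift matX} (h : ∀ i : ℤ, |i| ≤ (T.depth + 1 : ℕ) → x'.1 i = x.1 i) :
    T.len x' = T.len x := by
  rw [len, len, T.span_congr h, h 0 (by rw [abs_zero]; positivity)]

theorem read_congr {x x' : VertexShift matX} (h : ∀ i : ℤ, |i| ≤ (T.depth + 1 : ℕ) → x'.1 i = x.1 i) :
    T.read x' = T.read x := by
  have h' : ∀ d : ℕ, d ≤ T.depth → x'.1 (d + 1) = x.1 (d + 1) := fun d hd =>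
    h _ (by rw [← Nat.cast_succ, Nat.abs_cast]; omega)
  rw [read, read]
  congr 1
  funext i
  have hi := i.2
  refine decide_eq_decide.2 (and_congr ?_ (forall₂_congr fun j hj => ?_))
  · rw [VertexShift.shift_apply, VertexShift.shift_apply, h' i hi.le]
  · rw [VertexShift.shift_apply, VertexShift.shift_apply, h' j (by omega)]

theorem out_congr {x x' : VertexShift matX} (h : ∀ i : ℤ, |i| ≤ (T.depth + 1 : ℕ) → x'.1 i = x.1 i) :
    T.out x' = T.out x := by
  have := (T.span_spec x).2.1
  rw [out, out, outBits, outBits, T.read_congr h, T.span_congr h, h 0 (by rw [abs_zero]; positivity),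
    h (T.span x) (by rw [Nat.abs_cast]; omega)]

theorem out_getElem_ne_two (x : VertexShift matX) (i : ℕ) (h : i + 1 < (T.out x).length) :
    (T.out x)[i + 1] ≠ 2 := by
  by_cases h0 : x.1 0 = 2
  · simp only [T.out_of_two h0, List.getElem_cons_succ, List.getElem_map]
    exact bitSymbol_ne_two _
  · rw [T.out_of_ne_two h0] at h
    simp at h

/-- After a piece there is either a symbol `2` or a cell too far from the preceding `2`, and both
begin a piece. -/
theorem start_next {x : VertexShift matX} (hx : T.start x = 0) :
    T.start (x.shift (T.len x)) = 0 := by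
  by_cases h0 : x.1 0 = 2
  · rw [T.len_of_two h0]
    obtain ⟨h1, h2, h3, h4⟩ := T.span_spec x
    by_cases h5 : x.1 (T.span x) = 2
    · exact T.start_eq_zero_of_two (by rwa [VertexShift.shift_apply, zero_add])
    · refine T.start_eq_zero_of_far fun d hd => ?_
      have h6 := h3.resolve_left h5
      rw [VertexShift.shift_apply]
      rcases Nat.eq_zero_or_pos d with rfl | hd0
      · simpa using h5
      · rw [show (-(d : ℤ) + T.span x) = ((T.span x - d : ℕ) : ℤ) by omega]
        exact h4 _ (by omega) (by omega)
  · rw [T.len_of_ne_two h0]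
    have hfar := (T.eq_two_or_far_of_start_eq_zero hx).resolve_left h0
    by_cases h1 : x.1 1 = 2
    · exact T.start_eq_zero_of_two (by rwa [VertexShift.shift_apply, zero_add])
    · refine T.start_eq_zero_of_far fun d hd => ?_
      rw [VertexShift.shift_apply]
      rcases d with _ | d
      · simpa using h1
      · have := hfar d (by omega)
        push_cast
        rwa [neg_add_rev, add_comm (-1 : ℤ), add_assoc, neg_add_cancel, add_zero]

/-- The division of configurations into pieces on which the transformation described by the table
replaces one word by another. -/
noncomputable def code : BlockCode matX where
  start := T.start
  len := T.len
  out := T.out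
  isLocallyConstant_start :=
    VertexShift.isLocallyConstant_of_finite_dependence (T.depth + 1) fun _ _ => T.start_congr
  isLocallyConstant_len :=
    VertexShift.isLocallyConstant_of_finite_dependence (T.depth + 1) fun _ _ => T.len_congr
  isLocallyConstant_out :=
    VertexShift.isLocallyConstant_of_finite_dependence (T.depth + 1) fun _ _ => T.out_congr
  out_length_pos := T.out_length_pos
  start_base x := by
    rcases T.start_cases x with ⟨d, hd, h2, H⟩ | H
    · rw [T.start_eq hd h2 H]
      exact T.start_eq_zero_of_two (by rwa [VertexShift.shift_apply, zero_add])
    · rw [T.start_eq_zero_of_far H, Nat.cast_zero, neg_zero, x.shift_zero]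
      exact T.start_eq_zero_of_far H
  start_lt x := by
    rcases T.start_cases x with ⟨d, hd, h2, H⟩ | H
    · rw [T.start_eq hd h2 H, T.len_of_two (by rwa [VertexShift.shift_apply, zero_add])]
      obtain ⟨h1, h2', h3, h4⟩ := T.span_spec (x.shift (-(d : ℤ)))
      -- A piece that stopped earlier would do so at a symbol `2` nearer than the nearest one.
      by_contra hle
      push Not at hle
      rcases h3 with h3 | h3
      · refine H (d - T.span (x.shift (-(d : ℤ)))) (by omega) ?_
        rw [VertexShift.shift_apply] at h3
        rwa [Nat.cast_sub hle, neg_sub, sub_eq_add_neg]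
      · omega
    · rw [T.start_eq_zero_of_far H]
      rw [len]
      split_ifs
      · exact (T.span_spec _).1
      · exact one_pos
  start_shift x k hx hk := by
    by_cases h0 : x.1 0 = 2
    · rw [T.len_of_two h0] at hk
      obtain ⟨h1, h2, h3, h4⟩ := T.span_spec x
      refine T.start_eq (by omega) (by rwa [VertexShift.shift_apply, neg_add_cancel]) ?_
      intro e he
      rw [VertexShift.shift_apply, show (-(e : ℤ) + k) = ((k - e : ℕ) : ℤ) by omega]
      exact h4 _ (by omega) (by omega)
    · rw [T.len_of_ne_two h0, Nat.lt_one_iff] at hk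
      rw [hk, Nat.cast_zero, x.shift_zero, hx]
  start_next x hx := T.start_next hx
  out_adj x i h := by
    rw [matX_eq_one_iff]
    exact fun H => T.out_getElem_ne_two x i h H.2
  out_junction x hx := by
    rw [T.out_head, matX_eq_one_iff, VertexShift.shift_apply, zero_add]
    -- A word before a `2` does not end in `0`: a trimmed word ends in `1`, an empty one leaves the
    -- initial `2`, and a copied symbol precedes `2` already in `x`.
    rintro ⟨h, h2⟩
    by_cases h0 : x.1 0 = 2
    · rw [T.len_of_two h0] at h2
      have ho : T.out x = 2 :: (trim (T.value (T.read x))).map bitSymbol := by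
        rw [T.out_of_two h0, outBits, if_pos h2]
      rw [← List.getLast_eq_getElem (by rw [ho]; simp)] at h
      simp only [ho] at h
      by_cases hnil : trim (T.value (T.read x)) = []
      · simp [hnil] at h
      · rw [List.getLast_cons (by simpa using hnil), List.getLast_map (h := by simpa using hnil),
          getLast_trim _ hnil] at h
        simp [bitSymbol] at h
    · rw [T.len_of_ne_two h0] at h2
      simp only [T.out_of_ne_two h0] at h
      have := (matX_eq_one_iff _ _).1 (x.2 0)
      exact this ⟨by simpa using h, h2⟩

end UniformTable

/-! ### Maps are determined by the words that replace the pieces -/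

section PieceDetermination

variable {n : ℕ} {M : Matrix (Fin n) (Fin n) ℕ}

/-- Two maps that replace the pieces of a configuration by the same words agree on its orbit. -/
theorem eq_of_same_pieces {G G' : MappingTorus M → MappingTorus M} {x : VertexShift M}
    {P : ℤ → ℕ → Prop} (hcover : ∀ i : ℤ, ∃ p l, P p l ∧ p ≤ i ∧ i < p + l)
    (hnext : ∀ p l, P p l → ∃ l', P (p + l) l') (hprev : ∀ p l, P p l → ∃ l' : ℕ, P (p - l') l')
    (h : ∀ p l, P p l → ∃ (y y' : VertexShift M) (m : ℕ) (τ : ℝ → ℝ), 0 < m ∧ τ 0 = 0 ∧ τ l = m ∧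
      (∀ i : ℕ, i < m → y.1 i = y'.1 i) ∧ ∀ s ∈ Set.Icc (0 : ℝ) l,
        G (torusMk x (p + s)) = torusMk y (τ s) ∧ G' (torusMk x (p + s)) = torusMk y' (τ s))
    (t : ℝ) : G (torusMk x t) = G' (torusMk x t) := by
  have : Nonempty (VertexShift M) := ⟨x⟩
  choose! Y Y' m τ hm h0 hl hY hG using h
  -- Consecutive pieces share an endpoint; comparing the values there shows that their image
  -- configurations differ by the length of the first word.
  have hstep : ∀ p l l', P p l → P (p + l) l' →
      Y (p + l) l' = (Y p l).shift (m p l) ∧ Y' (p + l) l' = (Y' p l).shift (m p l) := by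
    intro p l l' h1 h2
    obtain ⟨e1, e2⟩ := hG p l h1 l ⟨Nat.cast_nonneg l, le_rfl⟩
    obtain ⟨e3, e4⟩ := hG _ l' h2 0 ⟨le_rfl, Nat.cast_nonneg l'⟩
    rw [hl p l h1] at e1 e2
    rw [h0 _ l' h2, add_zero] at e3 e4
    push_cast at e3 e4
    rw [e1] at e3
    rw [e2] at e4
    constructor
    · refine (torusMk_injective_left (t := 0) ?_).symm
      rw [← e3, torusMk_shift, zero_add]; rfl
    · refine (torusMk_injective_left (t := 0) ?_).symm
      rw [← e4, torusMk_shift, zero_add]; rfl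
  have hright : ∀ i : ℕ, ∀ p l, P p l → (Y p l).1 i = (Y' p l).1 i := by
    intro i
    induction i using Nat.strong_induction_on with
    | _ i ih =>
      intro p l hp
      rcases lt_or_ge i (m p l) with hi | hi
      · exact hY p l hp i hi
      · obtain ⟨l', hl'⟩ := hnext p l hp
        obtain ⟨e1, e2⟩ := hstep p l l' hp hl'
        have := ih (i - m p l) (by have := hm p l hp; omega) _ _ hl'
        rw [e1, e2, VertexShift.shift_apply, VertexShift.shift_apply] at this
        rwa [Nat.cast_sub hi, sub_add_cancel] at this
  -- Passing to the preceding piece either brings the cell to the right of its origin, where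
  -- `hright` applies, or brings it closer to the origin.
  have hleft : ∀ i : ℕ, ∀ p l, P p l → (Y p l).1 (-(i : ℤ)) = (Y' p l).1 (-(i : ℤ)) := by
    intro i
    induction i using Nat.strong_induction_on with
    | _ i ih =>
      intro p l hp
      obtain ⟨l', hl'⟩ := hprev p l hp
      obtain ⟨e1, e2⟩ := hstep (p - l') l' l hl' (by rwa [sub_add_cancel])
      rw [sub_add_cancel] at e1 e2
      rw [e1, e2, VertexShift.shift_apply, VertexShift.shift_apply]
      rcases le_or_gt i (m (p - l') l') with hi | hi
      · have := hright (m (p - l') l' - i) _ _ hl'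
        rw [Nat.cast_sub hi] at this
        rwa [neg_add_eq_sub]
      · have := ih (i - m (p - l') l') (by have := hm _ _ hl'; omega) _ _ hl'
        rw [Nat.cast_sub hi.le, neg_sub] at this
        rwa [neg_add_eq_sub]
  obtain ⟨p, l, hp, h1, h2⟩ := hcover ⌊t⌋
  have hp1 : (p : ℝ) ≤ t := (Int.cast_le.2 h1).trans (Int.floor_le t)
  have hp2 : t ≤ p + l := by
    have h3 : ((⌊t⌋ + 1 : ℤ) : ℝ) ≤ ((p + l : ℤ) : ℝ) := Int.cast_le.2 h2
    push_cast at h3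
    exact (Int.lt_floor_add_one t).le.trans h3
  obtain ⟨e1, e2⟩ := hG p l hp (t - p) ⟨by linarith, by linarith⟩
  rw [add_sub_cancel] at e1 e2
  have hYY : Y p l = Y' p l := by
    refine Subtype.ext (funext fun i => ?_)
    obtain ⟨k, rfl | rfl⟩ := i.eq_nat_or_neg
    · exact hright k p l hp
    · exact hleft k p l hp
  rw [e1, e2, hYY]

end PieceDetermination

/-! ### Finite blocks and blockwise actions -/

section Blocks

/-- A block, that is, a symbol `2` and the symbols up to the next `2`, of length `m` begins at
cell `0`. -/
def IsBlock (x : VertexShift matX) (m : ℕ) : Prop :=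
  0 < m ∧ x.1 0 = 2 ∧ x.1 m = 2 ∧ ∀ i : ℕ, 0 < i → i < m → x.1 i ≠ 2

theorem blockCode_of_ge {x : VertexShift matX} {m : ℕ} (hx : IsBlock x m) {i : ℕ} (hi : m ≤ i + 1) :
    blockCode x i = false := by
  obtain ⟨h0, -, h2, -⟩ := hx
  refine tailCode_of_two (k := m - 1) ?_ (by omega)
  rwa [VertexShift.shift_apply, Nat.cast_sub h0, Nat.cast_one, sub_add_cancel]

theorem bitSymbol_blockCode {x : VertexShift matX} {m : ℕ} (hx : IsBlock x m) {i : ℕ}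
    (hi : i + 1 < m) : bitSymbol (blockCode x i) = x.1 (i + 1 : ℕ) := by
  refine bitSymbol_tailCode fun j hj => ?_
  rw [VertexShift.shift_apply]
  exact hx.2.2.2 (j + 1) (Nat.succ_pos _) (by omega)

/-- A block is determined by its code. -/
theorem IsBlock.length_le {x y : VertexShift matX} {m k : ℕ} (hx : IsBlock x m) (hy : IsBlock y k)
    (h : blockCode x = blockCode y) : m ≤ k := by
  by_contra hlt
  push Not at hlt
  have hk := hy.1
  -- Index `m - 2` of the code is the last cell of the longer block. The shorter block has the digit
  -- zero there, which would put a `0` before the closing `2`.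
  have h1 := blockCode_of_ge hy (i := m - 2) (by omega)
  rw [← h] at h1
  have h2 := bitSymbol_blockCode hx (i := m - 2) (by omega)
  rw [h1] at h2
  refine (matX_eq_one_iff _ _).1 (x.2 (m - 2 + 1 : ℕ)) ⟨h2.symm, ?_⟩
  rw [← Nat.cast_succ, show (m - 2 + 1).succ = m by omega]
  exact hx.2.2.1

theorem IsBlock.length_eq {x y : VertexShift matX} {m k : ℕ} (hx : IsBlock x m) (hy : IsBlock y k)
    (h : blockCode x = blockCode y) : m = k :=
  le_antisymm (hx.length_le hy h) (hy.length_le hx h.symm)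

theorem IsBlock.apply_eq {x y : VertexShift matX} {m : ℕ} (hx : IsBlock x m) (hy : IsBlock y m)
    (h : blockCode x = blockCode y) {i : ℕ} (hi : i < m) : x.1 i = y.1 i := by
  rcases i with _ | i
  · exact hx.2.1.trans hy.2.1.symm
  · rw [← bitSymbol_blockCode hx hi, ← bitSymbol_blockCode hy hi, h]

/-- The map `G` applies the permutation `g` of Cantor space to all blocks, changing the lengths of
the blocks in the standard way. -/
def ActsBlockwise (g : Equiv.Perm Cantor) (G : MappingTorus matX → MappingTorus matX) : Prop :=
  ∀ x m, IsBlock x m → ∃ y m', IsBlock y m' ∧ blockCode y = g (blockCode x) ∧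
    ∀ s ∈ Set.Icc (0 : ℝ) m, G (torusMk x s) = torusMk y (restretch m m' s)

theorem ActsBlockwise.one : ActsBlockwise 1 id := fun x m hx =>
  ⟨x, m, hx, rfl, fun s _ => by rw [restretch_self]; rfl⟩

theorem ActsBlockwise.comp {f g : Equiv.Perm Cantor} {F G : MappingTorus matX → MappingTorus matX}
    (hF : ActsBlockwise f F) (hG : ActsBlockwise g G) : ActsBlockwise (f * g) (F ∘ G) := by
  intro x m hx
  obtain ⟨y, k, hy, hyc, hys⟩ := hG x m hx
  obtain ⟨z, l, hz, hzc, hzs⟩ := hF y k hy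
  refine ⟨z, l, hz, by rw [hzc, hyc]; rfl, fun s hs => ?_⟩
  rw [Function.comp, hys s hs, hzs, restretch_trans]
  constructor
  · rw [← restretch_zero m k]
    exact (restretch m k).monotone hs.1
  · rw [← restretch_right hx.1 hy.1]
    exact (restretch m k).monotone hs.2

/-- Replace the symbols far from cell `0` by `2`. -/
def fillTwo (K : ℕ) (x : VertexShift matX) : VertexShift matX :=
  -- The `1` at cell `K + 1` avoids `02` in case that `x` has a `0` at cell `K`. On the left no
  -- buffer is needed, since every symbol may follow `2`.
  ⟨fun i => if i < -K then 2 else if i ≤ K then x.1 i else if i = K + 1 then 1 else 2, fun i => by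
    have := (matX_eq_one_iff _ _).1 (x.2 i)
    rw [matX_eq_one_iff]
    rintro ⟨h1, h2⟩
    dsimp only at h1 h2
    split_ifs at h1 h2 <;> omega⟩

theorem tendsto_fillTwo (x : VertexShift matX) :
    Filter.Tendsto (fun K => fillTwo K x) Filter.atTop (𝓝 x) := by
  refine (tendsto_subtype_rng.2 (tendsto_pi_nhds.2 fun i => ?_) :
    Filter.Tendsto (fun K => fillTwo K x) Filter.atTop (@nhds {x : ℤ → Fin 3 // _} _ x))
  refine tendsto_const_nhds.congr' ?_
  filter_upwards [Filter.eventually_ge_atTop i.natAbs] with K hK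
  change _ = (if i < -K then 2 else if i ≤ K then x.1 i else if i = K + 1 then 1 else 2 : Fin 3)
  rw [if_neg (by omega), if_pos (by omega)]

theorem exists_isBlock_of_two {x : VertexShift matX} (h : ∀ i : ℤ, ∃ q, i < q ∧ x.1 q = 2) {p : ℤ}
    (hp : x.1 p = 2) : ∃ l, IsBlock (x.shift p) l := by
  obtain ⟨q, ⟨hq, hq2⟩, hmin⟩ := Int.exists_least_of_bdd (P := fun q => p < q ∧ x.1 q = 2)
    ⟨p, fun z hz => hz.1.le⟩ (h p)
  refine ⟨(q - p).toNat, by omega, ?_, ?_, fun i h0 hi H => ?_⟩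
  · rwa [VertexShift.shift_apply, zero_add]
  · rwa [VertexShift.shift_apply, Int.toNat_of_nonneg (by omega), sub_add_cancel]
  · have := hmin (i + p) ⟨by omega, H⟩
    omega

theorem exists_last_two {x : VertexShift matX} (h : ∀ i : ℤ, ∃ q, q < i ∧ x.1 q = 2) (i : ℤ) :
    ∃ p, p ≤ i ∧ x.1 p = 2 ∧ ∀ q, q ≤ i → x.1 q = 2 → q ≤ p := by
  obtain ⟨p, ⟨hp, hp2⟩, hmax⟩ := Int.exists_greatest_of_bdd (P := fun q => q ≤ i ∧ x.1 q = 2)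
    ⟨i, fun z hz => hz.1⟩ ((h i).imp fun q hq => ⟨hq.1.le, hq.2⟩)
  exact ⟨p, hp, hp2, fun q hq hq2 => hmax q ⟨hq, hq2⟩⟩

/-- A continuous map is determined by its action on blocks. -/
theorem ActsBlockwise.unique {g : Equiv.Perm Cantor} {G G' : MappingTorus matX → MappingTorus matX}
    (hG : ActsBlockwise g G) (hG' : ActsBlockwise g G') (hc : Continuous G) (hc' : Continuous G') :
    G = G' := by
  funext p
  obtain ⟨x, t, rfl⟩ := torusMk_surjective p
  -- Configurations with symbols `2` arbitrarily far on both sides consist of finite blocks; the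
  -- general case follows as a limit, the torus being Hausdorff.
  have key : ∀ K, G (torusMk (fillTwo K x) t) = G' (torusMk (fillTwo K x) t) := by
    intro K
    generalize hz : fillTwo K x = z
    have hr : ∀ i : ℤ, ∃ q, i < q ∧ z.1 q = 2 := fun i => by
      refine ⟨max (i + 1) (K + 2), by omega, ?_⟩
      rw [← hz]
      change (if _ then 2 else if _ then _ else if _ then _ else _ : Fin 3) = 2
      rw [if_neg (by omega), if_neg (by omega), if_neg (by omega)]
    have hl : ∀ i : ℤ, ∃ q, q < i ∧ z.1 q = 2 := fun i => by
      refine ⟨min (i - 1) (-K - 1), by omega, ?_⟩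
      rw [← hz]
      change (if _ then 2 else if _ then _ else if _ then _ else _ : Fin 3) = 2
      rw [if_pos (by omega)]
    refine eq_of_same_pieces (P := fun p l => IsBlock (z.shift p) l) ?_ ?_ ?_ ?_ t
    · intro i
      obtain ⟨p, hp, hp2, hmax⟩ := exists_last_two hl i
      obtain ⟨l, hbl⟩ := exists_isBlock_of_two hr hp2
      refine ⟨p, l, hbl, hp, ?_⟩
      by_contra hle
      push Not at hle
      have := hmax (p + l) hle (by
        have := hbl.2.2.1
        rwa [VertexShift.shift_apply, add_comm] at this)
      have := hbl.1
      omega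
    · intro p l hp
      exact exists_isBlock_of_two hr (by
        have := hp.2.2.1
        rwa [VertexShift.shift_apply, add_comm] at this)
    · intro p l hp
      have hp2 : z.1 p = 2 := by
        have := hp.2.1
        rwa [VertexShift.shift_apply, zero_add] at this
      obtain ⟨q, hq, hq2, hmax⟩ := exists_last_two hl (p - 1)
      have he : p - ((p - q).toNat : ℤ) = q := by omega
      refine ⟨(p - q).toNat, ?_⟩
      rw [he]
      refine ⟨by omega, ?_, ?_, fun i h0 hi H => ?_⟩
      · rwa [VertexShift.shift_apply, zero_add]
      · rwa [VertexShift.shift_apply, Int.toNat_of_nonneg (by omega), sub_add_cancel]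
      · have := hmax (i + q) (by omega) H
        omega
    · intro p l hp
      obtain ⟨y, m, hy, hyc, hys⟩ := hG _ _ hp
      obtain ⟨y', m', hy', hyc', hys'⟩ := hG' _ _ hp
      -- Both images of the block have the same code, hence the same length and the same
      -- parametrization.
      obtain rfl := hy.length_eq hy' (hyc.trans hyc'.symm)
      refine ⟨y, y', m, restretch l m, hy.1, restretch_zero _ _, restretch_right hp.1 hy.1,
        fun i hi => hy.apply_eq hy' (hyc.trans hyc'.symm) hi, fun s hs => ?_⟩
      rw [← hys s hs, ← hys' s hs, torusMk_shift, add_comm]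
      exact ⟨rfl, rfl⟩
  have ht : Filter.Tendsto (fun K => torusMk (fillTwo K x) t) Filter.atTop (𝓝 (torusMk x t)) :=
    ((continuous_torusMk_comp continuous_id continuous_const).tendsto x).comp (tendsto_fillTwo x)
  refine tendsto_nhds_unique ((hc.tendsto _).comp ht) ?_
  refine ((hc'.tendsto _).comp ht).congr fun K => ?_
  exact (key K).symm

end Blocks

/-! ### Uniform tables act blockwise -/

theorem prepend_ofFn (z : Cantor) (k : ℕ) :
    z = prepend (List.ofFn fun i : Fin k => z i) fun i => z (i + k) := by
  funext i
  rcases lt_or_ge i k with hi | hi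
  · rw [prepend_of_lt (by rwa [List.length_ofFn]), List.getElem_ofFn]
  · rw [prepend_of_ge (by rwa [List.length_ofFn]), List.length_ofFn, Nat.sub_add_cancel hi]

/-- Every element of Thompson's group has a table on the words of some fixed length. -/
theorem IsPrefixReplacement.nonempty_uniformTable {g : Equiv.Perm Cantor}
    (hg : IsPrefixReplacement g) : Nonempty (UniformTable g) := by
  obtain ⟨P, hP, hP'⟩ := hg
  -- One more than the longest word of the table, so that a nonempty rest `r` remains and the values
  -- are nonempty.
  let N := P.sup (fun p => p.1.length) + 1
  have key : ∀ u : List Bool, ∃ v : List Bool, u.length = N →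
      0 < v.length ∧ ∀ z, g (prepend u z) = prepend v z := by
    intro u
    by_cases hu : u.length = N
    · obtain ⟨p, hp, y, hy⟩ := hP (prepend u fun _ => false)
      have hle : p.1.length ≤ P.sup fun p => p.1.length := Finset.le_sup (f := fun p => p.1.length) hp
      obtain ⟨r, hr⟩ := prepend_comparable hy.symm (by omega)
      refine ⟨p.2 ++ r, fun _ => ⟨?_, fun z => ?_⟩⟩
      · have := congrArg List.length hr
        rw [List.length_append] at this ⊢
        omega
      · rw [hr, prepend_append, hP' p hp, prepend_append]
    · exact ⟨[], fun h => absurd h hu⟩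
  choose v hv using key
  exact ⟨⟨N, v, Nat.succ_pos _, fun u hu => (hv u hu).2, fun u hu => (hv u hu).1⟩⟩

namespace UniformTable

variable {g : Equiv.Perm Cantor} (T : UniformTable g)

theorem image_apply_of_lt {x : VertexShift matX} (hx : T.start x = 0) {i : ℕ}
    (hi : i < (T.out x).length) : (T.code.image x).1 i = (T.out x)[i] := by
  rw [T.code.image_of_start_eq_zero hx]
  exact T.code.word_of_lt x hi

theorem image_apply_zero {x : VertexShift matX} (hx : T.start x = 0) :
    (T.code.image x).1 0 = x.1 0 :=
  (T.image_apply_of_lt hx (T.out_length_pos x)).trans (T.out_head x)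

theorem image_apply_succ {x : VertexShift matX} (hx : T.start x = 0) (h2 : x.1 0 = 2) {i : ℕ}
    (hi : i < (T.outBits x).length) :
    (T.code.image x).1 ((i + 1 : ℕ) : ℤ) = bitSymbol (T.outBits x)[i] := by
  have ho := T.out_of_two h2
  rw [T.image_apply_of_lt hx (by rw [ho]; simpa using hi)]
  simp [ho]

theorem image_next {x : VertexShift matX} (hx : T.start x = 0) :
    T.code.image (x.shift (T.len x)) = (T.code.image x).shift (T.out x).length :=
  T.code.image_next hx

/-- Cells after the first piece of a block are copied. -/
theorem copy_of_far {x : VertexShift matX} (h : ∀ d : ℕ, d ≤ T.depth → x.1 (-(d : ℤ)) ≠ 2) :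
    T.start x = 0 ∧ T.code.image (x.shift 1) = (T.code.image x).shift 1 ∧
      ∀ s ∈ Set.Icc (0 : ℝ) 1, T.code.map (torusMk x s) = torusMk (T.code.image x) s := by
  have h0 : x.1 0 ≠ 2 := by simpa using h 0 (Nat.zero_le _)
  have hs := T.start_eq_zero_of_far h
  refine ⟨hs, ?_, fun s hs' => ?_⟩
  · have := T.image_next hs
    rw [T.len_of_ne_two h0, T.out_of_ne_two h0] at this
    simpa using this
  · have hl : T.code.len x = 1 := T.len_of_ne_two h0
    have ho : T.code.out x = [x.1 0] := T.out_of_ne_two h0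
    have := T.code.map_piece (x := x) hs (s := s) (by rw [hl]; simpa using hs')
    rw [hl, ho, List.length_singleton, restretch_self] at this
    exact this

theorem map_of_two {x : VertexShift matX} (h0 : x.1 0 = 2) {s : ℝ}
    (hs : s ∈ Set.Icc (0 : ℝ) (T.span x)) :
    T.code.map (torusMk x s) =
      torusMk (T.code.image x) (restretch (T.span x) ((T.outBits x).length + 1) s) := by
  have hl : T.code.len x = T.span x := T.len_of_two h0
  have ho : T.code.out x = 2 :: (T.outBits x).map bitSymbol := T.out_of_two h0
  have := T.code.map_piece (x := x) (T.start_eq_zero_of_two h0) (s := s) (by rwa [hl])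
  rw [hl, ho] at this
  simpa using this

theorem image_next_of_two {x : VertexShift matX} (h0 : x.1 0 = 2) :
    T.code.image (x.shift (T.span x)) =
      (T.code.image x).shift ((T.outBits x).length + 1 : ℕ) := by
  have := T.image_next (T.start_eq_zero_of_two h0)
  rw [T.len_of_two h0, T.out_of_two h0] at this
  simpa using this

theorem blockCode_image {x : VertexShift matX} (h0 : x.1 0 = 2) :
    blockCode (T.code.image x) = prepend (T.outBits x)
      (tailCode ((T.code.image x).shift ((T.outBits x).length + 1 : ℕ))) := by
  rw [blockCode, tailCode_append (l := T.outBits x), VertexShift.shift_shift, Nat.cast_succ]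
  intro i hi
  rw [VertexShift.shift_apply, ← Nat.cast_succ]
  exact T.image_apply_succ (T.start_eq_zero_of_two h0) h0 hi

theorem image_apply_ne_two {x : VertexShift matX} (h0 : x.1 0 = 2) {i : ℕ} (hi0 : 0 < i)
    (hi : i < (T.outBits x).length + 1) : (T.code.image x).1 i ≠ 2 := by
  obtain ⟨i, rfl⟩ := Nat.exists_eq_succ_of_ne_zero hi0.ne'
  rw [Nat.succ_eq_add_one, T.image_apply_succ (T.start_eq_zero_of_two h0) h0 (by omega)]
  exact bitSymbol_ne_two _

/-- The whole block is one piece. The digits read are completed by zeros, which agrees with the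
code, and trimming the output does not change the coded point. -/
theorem actsBlockwise_of_short {x : VertexShift matX} {m : ℕ} (hx : IsBlock x m)
    (hm : m ≤ T.depth + 1) :
    ∃ y m', IsBlock y m' ∧ blockCode y = g (blockCode x) ∧
      ∀ s ∈ Set.Icc (0 : ℝ) m, T.code.map (torusMk x s) = torusMk y (restretch m m' s) := by
  have h0 := hx.2.1
  have hspan : T.span x = m := T.span_eq hx.1 hm (Or.inl hx.2.2.1) hx.2.2.2
  have hend : (T.code.image x).1 ((T.outBits x).length + 1 : ℕ) = 2 := by
    have h1 := T.image_next_of_two h0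
    rw [hspan] at h1
    have h2 : (x.shift m).1 0 = 2 := by
      rw [VertexShift.shift_apply, zero_add]; exact hx.2.2.1
    have h3 := T.image_apply_zero (T.start_eq_zero_of_two h2)
    rw [h1, h2, VertexShift.shift_apply, zero_add] at h3
    exact h3
  refine ⟨T.code.image x, (T.outBits x).length + 1, ⟨Nat.succ_pos _, ?_, hend, fun i hi0 hi =>
    T.image_apply_ne_two h0 hi0 hi⟩, ?_, fun s hs => ?_⟩
  · rw [T.image_apply_zero (T.start_eq_zero_of_two h0), h0]
  · have hbits : T.outBits x = trim (T.value (T.read x)) := by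
      rw [outBits, hspan, if_pos hx.2.2.1]
    have hx' : blockCode x = prepend (T.read x) fun _ => false := by
      conv_lhs => rw [prepend_ofFn (blockCode x) T.depth]
      rw [read]
      congr 1
      funext i
      exact blockCode_of_ge hx (by omega)
    rw [T.blockCode_image h0, hx', T.apply_prepend _ (T.length_read x), ← prepend_trim, ← hbits]
    congr 1
    funext i
    refine tailCode_of_two (k := 0) ?_ (Nat.zero_le _)
    rw [VertexShift.shift_apply, Nat.cast_zero, zero_add]
    exact hend
  · rw [T.map_of_two h0 (by rwa [hspan]), hspan]

/-- Only the first piece, a `2` and `T.depth` digits, is rewritten; the other cells are copied one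
by one. By `restretch_add` and `restretch_of_ge` this is the standard map between the whole blocks.
-/
theorem actsBlockwise_of_long {x : VertexShift matX} {m : ℕ} (hx : IsBlock x m)
    (hm : T.depth + 1 < m) :
    ∃ y m', IsBlock y m' ∧ blockCode y = g (blockCode x) ∧
      ∀ s ∈ Set.Icc (0 : ℝ) m, T.code.map (torusMk x s) = torusMk y (restretch m m' s) := by
  have h0 := hx.2.1
  have hspan : T.span x = T.depth + 1 :=
    T.span_eq (Nat.succ_pos _) le_rfl (Or.inr rfl) fun i hi0 hi => hx.2.2.2 i hi0 (by omega)
  have hne : x.1 (T.depth + 1 : ℕ) ≠ 2 := hx.2.2.2 _ (Nat.succ_pos _) hm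
  have hbits : T.outBits x = T.value (T.read x) := by
    rw [outBits, hspan, if_neg hne]
  have hpos : 0 < (T.outBits x).length := by
    rw [hbits]; exact T.value_length_pos _ (T.length_read x)
  set y := T.code.image x with hy
  set b := (T.outBits x).length + 1 with hb
  have hfar : ∀ j : ℕ, T.depth + 1 + j < m → ∀ d : ℕ, d ≤ T.depth →
      (x.shift (T.depth + 1 + j : ℕ)).1 (-(d : ℤ)) ≠ 2 := fun j hj d hd => by
    rw [VertexShift.shift_apply,
      show (-(d : ℤ) + (T.depth + 1 + j : ℕ)) = ((T.depth + 1 + j - d : ℕ) : ℤ) by omega]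
    exact hx.2.2.2 _ (by omega) (by omega)
  have himage : ∀ j : ℕ, T.depth + 1 + j ≤ m →
      T.code.image (x.shift (T.depth + 1 + j : ℕ)) = y.shift (b + j : ℕ) := by
    intro j
    induction j with
    | zero =>
      intro _
      have := T.image_next_of_two h0
      rwa [hspan] at this
    | succ j ih =>
      intro hj
      have h1 := (T.copy_of_far (hfar j (by omega))).2.1
      rw [ih (by omega), VertexShift.shift_shift, VertexShift.shift_shift] at h1
      have e1 : (1 + (T.depth + 1 + j : ℕ) : ℤ) = (T.depth + 1 + (j + 1) : ℕ) := by omega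
      have e2 : (1 + (b + j : ℕ) : ℤ) = (b + (j + 1) : ℕ) := by omega
      rwa [e1, e2] at h1
  have hcopy : ∀ j : ℕ, T.depth + 1 + j ≤ m → y.1 (b + j : ℕ) = x.1 (T.depth + 1 + j : ℕ) := by
    intro j hj
    have hs : T.start (x.shift (T.depth + 1 + j : ℕ)) = 0 := by
      rcases hj.lt_or_eq with hj | hj
      · exact T.start_eq_zero_of_far (hfar j hj)
      · refine T.start_eq_zero_of_two ?_
        rw [VertexShift.shift_apply, zero_add, hj]
        exact hx.2.2.1
    have := T.image_apply_zero hs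
    rwa [himage j hj, VertexShift.shift_apply, VertexShift.shift_apply, zero_add, zero_add] at this
  obtain ⟨k, hk⟩ := Nat.exists_eq_add_of_le hm.le
  refine ⟨y, b + k, ⟨by omega, ?_, ?_, fun i hi0 hi => ?_⟩, ?_, fun s hs => ?_⟩
  · rw [hy, T.image_apply_zero (T.start_eq_zero_of_two h0), h0]
  · rw [hcopy k hk.ge, ← hk]; exact hx.2.2.1
  · rcases lt_or_ge i b with hib | hib
    · exact T.image_apply_ne_two h0 hi0 hib
    · obtain ⟨j, rfl⟩ := Nat.exists_eq_add_of_le hib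
      rw [hcopy j (by omega)]
      exact hx.2.2.2 _ (by omega) (by omega)
  · have hx' : blockCode x = prepend (T.read x) (tailCode (x.shift (T.depth + 1 : ℕ))) := by
      rw [blockCode, tailCode_append (l := T.read x), VertexShift.shift_shift, T.length_read,
        Nat.cast_succ]
      intro i hi
      rw [T.length_read] at hi
      simp only [read, List.getElem_ofFn]
      rw [bitSymbol_blockCode hx (by omega), VertexShift.shift_apply, Nat.cast_succ]
    rw [T.blockCode_image h0, hx', T.apply_prepend _ (T.length_read x), ← hbits, ← hb, ← hy]
    congr 1
    -- The copied digits agree up to the closing `2`, and the code of a tail ignores what follows.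
    refine tailCode_congr (k := k) ?_ fun i hi => ?_
    · rw [VertexShift.shift_apply, ← Nat.cast_add, add_comm, ← hk]
      exact hx.2.2.1
    · rw [VertexShift.shift_apply, VertexShift.shift_apply, ← Nat.cast_add, ← Nat.cast_add,
        add_comm i, add_comm i]
      exact hcopy i (by omega)
  · have hd := T.depth_pos
    have hr : restretch m (b + k) = restretch (T.depth + 1) b := by
      rw [hk]; exact restretch_add (by omega) (by omega) k
    rw [hr]
    rcases le_total s (T.depth + 1 : ℕ) with hs' | hs'
    · rw [T.map_of_two h0 (by rw [hspan]; exact ⟨hs.1, hs'⟩), hspan]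
    · rw [restretch_of_ge (by omega) (by omega) hs']
      obtain ⟨j, hj, hj0, hj1⟩ : ∃ j : ℕ, T.depth + 1 + j < m ∧ ((T.depth + 1 + j : ℕ) : ℝ) ≤ s ∧
          s ≤ (T.depth + 1 + j : ℕ) + 1 := by
        rcases hs.2.lt_or_eq with h | rfl
        · have h1 : T.depth + 1 ≤ ⌊s⌋₊ := Nat.le_floor hs'
          obtain ⟨j, hj⟩ := Nat.exists_eq_add_of_le h1
          refine ⟨j, ?_, ?_, ?_⟩ <;> rw [← hj]
          · exact (Nat.floor_lt hs.1).2 h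
          · exact Nat.floor_le hs.1
          · exact (Nat.lt_floor_add_one s).le
        · refine ⟨k - 1, by omega, ?_, ?_⟩
          · exact Nat.cast_le.2 (by omega)
          · rw [← Nat.cast_succ]; exact Nat.cast_le.2 (by omega)
      have := (T.copy_of_far (hfar j hj)).2.2 (s - (T.depth + 1 + j : ℕ))
        ⟨by linarith, by linarith⟩
      rw [himage j hj.le, torusMk_shift, torusMk_shift] at this
      rw [Int.cast_natCast, Int.cast_natCast, sub_add_cancel] at this
      rw [this]
      congr 1
      push_cast
      ring

theorem actsBlockwise : ActsBlockwise g T.code.map := fun x m hx => by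
  rcases le_or_gt m (T.depth + 1) with hm | hm
  · exact T.actsBlockwise_of_short hx hm
  · exact T.actsBlockwise_of_long hx hm

end UniformTable

/-! ### The action of `V` and its faithfulness up to isotopy -/

section Representation

/-- A chosen table of an element of Thompson's group. -/
noncomputable def tableOf (g : thompsonV) : UniformTable g.1 :=
  (IsPrefixReplacement.nonempty_uniformTable g.2).some

theorem ActsBlockwise.comp_eq_id {f g : Equiv.Perm Cantor}
    {F G : MappingTorus matX → MappingTorus matX} (hF : ActsBlockwise f F)
    (hG : ActsBlockwise g G) (hF' : Continuous F) (hG' : Continuous G) (h : f * g = 1) :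
    F ∘ G = id :=
  ActsBlockwise.unique (h ▸ hF.comp hG) ActsBlockwise.one (hF'.comp hG') continuous_id

/-- The homeomorphism by which an element of Thompson's group acts on blocks. -/
noncomputable def blockHomeo (g : thompsonV) : MappingTorus matX ≃ₜ MappingTorus matX where
  toFun := (tableOf g).code.map
  invFun := (tableOf g⁻¹).code.map
  left_inv := congrFun ((tableOf g⁻¹).actsBlockwise.comp_eq_id (tableOf g).actsBlockwise
    (tableOf g⁻¹).code.continuous_map (tableOf g).code.continuous_map (inv_mul_cancel g.1))
  right_inv := congrFun ((tableOf g).actsBlockwise.comp_eq_id (tableOf g⁻¹).actsBlockwise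
    (tableOf g).code.continuous_map (tableOf g⁻¹).code.continuous_map (mul_inv_cancel g.1))
  continuous_toFun := (tableOf g).code.continuous_map
  continuous_invFun := (tableOf g⁻¹).code.continuous_map

theorem blockHomeo_mem (g : thompsonV) : blockHomeo g ∈ OPHomeo matX := by
  refine isOrientationPreserving_of_increasing _ fun x =>
    ⟨(tableOf g).code.image x, 0, 1, (tableOf g).code.cellMap x, one_pos, ?_, ?_,
      fun s hs => (tableOf g).code.map_cell x hs⟩
  · exact ((restretch _ _).continuous.comp (continuous_const_add _)).continuousOn
  · exact (restretch _ _).strictMono (by linarith)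

/-- The action of Thompson's group on the mapping torus. -/
noncomputable def blockAction : thompsonV →* OPHomeo matX :=
  MonoidHom.mk' (fun g => ⟨blockHomeo g, blockHomeo_mem g⟩) fun f g =>
    Subtype.ext (Homeomorph.ext (congrFun (ActsBlockwise.unique (tableOf (f * g)).actsBlockwise
      ((tableOf f).actsBlockwise.comp (tableOf g).actsBlockwise) (tableOf (f * g)).code.continuous_map
      ((tableOf f).code.continuous_map.comp (tableOf g).code.continuous_map))))

theorem blockAction_apply (g : thompsonV) (p : MappingTorus matX) :
    (blockAction g).1 p = (tableOf g).code.map p := rfl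

/-- Any table of an element can be used to compute its action. -/
theorem blockAction_eq_map {g : thompsonV} (T : UniformTable g.1) (p : MappingTorus matX) :
    (blockAction g).1 p = T.code.map p :=
  congrFun (ActsBlockwise.unique (tableOf g).actsBlockwise T.actsBlockwise
    (tableOf g).code.continuous_map T.code.continuous_map) p

theorem isPiecewiseLinear_blockAction (g : thompsonV) : IsPiecewiseLinear (blockAction g) :=
  fun x t => (tableOf g).code.map_piecewiseLinear x t

/-- A configuration with a single block that is not a single `2` and with symbols `1` on its
left. -/
theorem exists_isolated_block {z : Cantor} {K : ℕ} (hz : ∀ i, K ≤ i → z i = false) :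
    ∃ (x : VertexShift matX) (m : ℕ), IsBlock x m ∧ blockCode x = z ∧ ∀ i < 0, x.1 i = 1 := by
  classical
  -- For the least such `L` the last digit before the closing `2` is `1`, so `02` does not occur.
  have hex : ∃ L, ∀ i, L ≤ i → z i = false := ⟨K, hz⟩
  set L := Nat.find hex with hL
  have hL0 : ∀ i, L ≤ i → z i = false := Nat.find_spec hex
  have hL1 : ∀ i, i + 1 = L → z i = true := by
    intro i hi
    by_contra hne
    have := Nat.find_min hex (m := i) (by omega)
    refine this fun j hj => ?_
    rcases hj.eq_or_lt with rfl | hj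
    · simpa using hne
    · exact hL0 j (by omega)
  let f : ℤ → Fin 3 := fun i => if i < 0 then 1 else if i = 0 then 2 else
    if i ≤ L then bitSymbol (z (i - 1).toNat) else 2
  have hf : ∀ i, matX (f i) (f (i + 1)) = 1 := by
    intro i
    rw [matX_eq_one_iff]
    rintro ⟨h1, h2⟩
    simp only [f] at h1 h2
    split_ifs at h1 with h3 h4 h5
    · exact absurd h1 (by decide)
    · exact absurd h1 (by decide)
    · rw [if_neg (by omega), if_neg (by omega)] at h2
      split_ifs at h2 with h6
      · exact bitSymbol_ne_two _ h2
      · rw [hL1 _ (by omega)] at h1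
        exact absurd h1 (by decide)
    · exact absurd h1 (by decide)
  have hmid : ∀ i : ℕ, i < L → f (i + 1) = bitSymbol (z i) := fun i hi => by
    simp only [f]
    rw [if_neg (by omega), if_neg (by omega), if_pos (by omega), add_sub_cancel_right,
      Int.toNat_natCast]
  have hend : f (L + 1) = 2 := by
    simp only [f]
    rw [if_neg (by omega), if_neg (by omega), if_neg (by omega)]
  have hblock : IsBlock ⟨f, hf⟩ (L + 1) := by
    refine ⟨Nat.succ_pos _, ?_, ?_, ?_⟩
    · simp [f]
    · exact_mod_cast hend
    · intro i hi0 hi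
      obtain ⟨i, rfl⟩ := Nat.exists_eq_succ_of_ne_zero hi0.ne'
      have := hmid i (by omega)
      rw [← Nat.cast_succ] at this
      exact this.trans_ne (bitSymbol_ne_two _)
  refine ⟨⟨f, hf⟩, L + 1, hblock, funext fun i => ?_, fun i hi => if_pos hi⟩
  rcases lt_or_ge i L with hi | hi
  · have h1 := bitSymbol_blockCode hblock (i := i) (by omega)
    have h2 := hmid i hi
    rw [Nat.cast_succ] at h1
    refine (decide_bitSymbol _).symm.trans (Eq.trans ?_ (decide_bitSymbol (z i)))
    exact congrArg (fun e : Fin 3 => decide (e = 1)) (h1.trans h2)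
  · rw [hL0 i hi]
    exact blockCode_of_ge hblock (by omega)

/-- An element that preserves all flow orbits fixes all eventually vanishing sequences. -/
theorem apply_eq_of_preserves_orbits {g : thompsonV}
    (hg : ∀ x : VertexShift matX, ∃ t, (blockAction g).1 (torusMk x 0) = torusMk x t)
    {z : Cantor} {K : ℕ} (hz : ∀ i, K ≤ i → z i = false) : g.1 z = z := by
  obtain ⟨x, m, hx, rfl, hleft⟩ := exists_isolated_block hz
  set T := tableOf g
  obtain ⟨y, m', hy, hyc, hys⟩ := T.actsBlockwise x m hx
  have hs := T.start_eq_zero_of_two hx.2.1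
  have h1 := hys 0 ⟨le_rfl, Nat.cast_nonneg m⟩
  have h2 := T.code.map_piece (x := x) hs (s := 0) ⟨le_rfl, Nat.cast_nonneg _⟩
  rw [restretch_zero] at h1 h2
  obtain rfl : y = T.code.image x := torusMk_injective_left (h1.symm.trans h2)
  obtain ⟨t, ht⟩ := hg x
  rw [blockAction_apply, h1] at ht
  obtain ⟨k, hk, -⟩ := torusMk_eq_iff.1 ht.symm
  have hfar : ∀ j : ℕ, 0 < j → ∀ d : ℕ, d ≤ T.depth → (x.shift (-(j : ℤ))).1 (-(d : ℤ)) ≠ 2 := by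
    intro j hj d _
    rw [VertexShift.shift_apply, hleft _ (by omega)]
    decide
  have himage : ∀ j : ℕ, T.code.image x = (T.code.image (x.shift (-(j : ℤ)))).shift j := by
    intro j
    induction j with
    | zero => rw [Nat.cast_zero, neg_zero, VertexShift.shift_zero, VertexShift.shift_zero]
    | succ j ih =>
      have := (T.copy_of_far (hfar (j + 1) (Nat.succ_pos _))).2.1
      rw [VertexShift.shift_shift] at this
      rw [ih, show (-(j : ℤ)) = 1 + -((j + 1 : ℕ) : ℤ) by push_cast; ring, this,
        VertexShift.shift_shift, Nat.cast_succ]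
  have hy0 : (T.code.image x).1 0 = 2 := (T.image_apply_zero hs).trans hx.2.1
  -- The symbols `1` on the left are copied, so both `x` and its image have their leftmost `2` at
  -- cell `0`; a nontrivial shift would move it.
  have hk0 : k = 0 := by
    rcases lt_trichotomy k 0 with h | h | h
    · rw [hk, VertexShift.shift_apply, zero_add, hleft k h] at hy0
      exact absurd hy0 (by decide)
    · exact h
    · exfalso
      obtain ⟨j, rfl⟩ := Int.eq_ofNat_of_zero_le h.le
      have h3 := congrArg (fun u : VertexShift matX => u.1 (-(j : ℤ))) hk
      simp only [VertexShift.shift_apply, neg_add_cancel, hx.2.1] at h3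
      rw [himage j, VertexShift.shift_apply, neg_add_cancel,
        T.image_apply_zero (T.start_eq_zero_of_far (hfar j (by omega))), VertexShift.shift_apply,
        zero_add, hleft _ (by omega)] at h3
      exact absurd h3 (by decide)
  rw [← hyc, hk, hk0, VertexShift.shift_zero]

theorem eq_one_of_preserves_orbits {g : thompsonV}
    (hg : ∀ x : VertexShift matX, ∃ t, (blockAction g).1 (torusMk x 0) = torusMk x t) : g = 1 := by
  refine Subtype.ext (Equiv.ext fun y => ?_)
  set T := tableOf g
  change g.1 y = y
  rw [prepend_ofFn y T.depth]
  set u := List.ofFn fun i : Fin T.depth => y i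
  have hu : u.length = T.depth := List.length_ofFn
  generalize (fun i => y (i + T.depth)) = z
  rw [T.apply_prepend u hu]
  funext i
  -- Coordinate `i` of a prefixed sequence depends only on the coordinates of `z` up to `i`, so `z`
  -- may be truncated to an eventually vanishing sequence.
  let z' : Cantor := fun j => if j ≤ i then z j else false
  have h := apply_eq_of_preserves_orbits hg (z := prepend u z') (K := u.length + i + 1) fun j hj => by
    rw [prepend_of_ge (by omega)]
    exact if_neg (by omega)
  rw [T.apply_prepend u hu] at h
  have hz : ∀ l : List Bool, prepend l z' i = prepend l z i := fun l => by
    rcases lt_or_ge i l.length with hi | hi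
    · rw [prepend_of_lt hi, prepend_of_lt hi]
    · rw [prepend_of_ge hi, prepend_of_ge hi]
      exact if_pos (Nat.sub_le _ _)
  rw [← hz, ← hz, h]

/-- The action of Thompson's group is faithful up to isotopy. -/
theorem mk_blockAction_injective : Function.Injective
    ((QuotientGroup.mk' (isotopicToId matX)).comp blockAction) := by
  refine (injective_iff_map_eq_one _).2 fun g hg => ?_
  exact eq_one_of_preserves_orbits fun x =>
    exists_flow_of_mem_isotopicToId ((QuotientGroup.eq_one_iff _).1 hg) x

end Representation

/-! ## The relators -/

section Relators

/-- Let a generator act on the infinite words with a given prefix, if the prefix is long enough. -/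
def Gen.actPrefix (s : Gen) (u : List Bool) : Option (List Bool) :=
  match s, u with
  | .a, true :: r => some (true :: r)
  | .a, false :: e :: r => some (false :: (!e) :: r)
  | .b, false :: false :: r => some (false :: false :: r)
  | .b, false :: true :: r => some (true :: false :: r)
  | .b, true :: false :: r => some (true :: true :: r)
  | .b, true :: true :: r => some (false :: true :: r)
  | .c, true :: r => some (false :: false :: r)
  | .c, false :: false :: r => some (true :: r)
  | .c, false :: true :: r => some (false :: true :: r)
  | _, _ => none

theorem prepend_cons_zero (b : Bool) (u : List Bool) (z : Cantor) : prepend (b :: u) z 0 = b := rfl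

theorem prepend_cons_succ (b : Bool) (u : List Bool) (z : Cantor) (n : ℕ) :
    prepend (b :: u) z (n + 1) = prepend u z n := by
  simp [prepend]

theorem prepend_nil (z : Cantor) : prepend [] z = z := by
  funext n; simp [prepend]

theorem Gen.perm_prepend {s : Gen} {u v : List Bool} (h : s.actPrefix u = some v) (z : Cantor) :
    s.perm (prepend u z) = prepend v z := by
  rcases s <;> rcases u with _ | ⟨_ | _, _ | ⟨_ | _, u⟩⟩ <;> simp only [Gen.actPrefix,
    Option.some.injEq, reduceCtorEq] at h <;> subst h <;> funext n <;> rcases n with _ | _ | n <;>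
    simp [Gen.perm, rewritePrefix, Gen.prefixTable, HasPrefix, Fin.forall_fin_succ,
      prepend_cons_zero, prepend_cons_succ, prepend_nil]

/-- Let a word in the generators act from the right on the infinite words with a given prefix. -/
def actPrefixes : List Gen → List Bool → Option (List Bool)
  | [], u => some u
  | s :: w, u => (s.actPrefix u).bind (actPrefixes w)

/-- Check that a word in the generators acts trivially on all infinite words with a given
prefix. -/
def actsTrivially (w : List Gen) : ℕ → List Bool → Bool
  | 0, u => actPrefixes w u == some u
  | k + 1, u => match actPrefixes w u with
    | some v => v == u
    | none => actsTrivially w k (u ++ [false]) && actsTrivially w k (u ++ [true])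

theorem foldl_apply_of_actPrefixes {w : List Gen} {u v : List Bool}
    (h : actPrefixes w u = some v) (z : Cantor) (f : Equiv.Perm Cantor) (y : Cantor)
    (hf : f y = prepend u z) : (w.foldl (fun (h : Equiv.Perm Cantor) (s : Gen) => s.perm * h) f) y = prepend v z := by
  induction w generalizing u f with
  | nil =>
    simp only [actPrefixes, Option.some.injEq] at h
    rw [← h]; exact hf
  | cons s w ih =>
    obtain ⟨u', hu, hu'⟩ := Option.bind_eq_some_iff.1 h
    exact ih hu' (s.perm * f) (by rw [Equiv.Perm.mul_apply, hf, s.perm_prepend hu])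

theorem foldl_apply_of_actsTrivially {w : List Gen} {k : ℕ} {u : List Bool}
    (h : actsTrivially w k u = true) (z : Cantor) :
    (w.foldl (fun (h : Equiv.Perm Cantor) (s : Gen) => s.perm * h) 1) (prepend u z) = prepend u z := by
  induction k generalizing u z with
  | zero => exact foldl_apply_of_actPrefixes (by simpa [actsTrivially] using h) z 1 _ rfl
  | succ k ih =>
    rw [actsTrivially] at h
    split at h
    · next v hv =>
      have : v = u := by simpa using h
      exact foldl_apply_of_actPrefixes (this ▸ hv) z 1 _ rfl
    · simp only [Bool.and_eq_true] at h
      have hz : prepend u z = prepend (u ++ [z 0]) fun n => z (n + 1) := by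
        rw [prepend_append]
        congr 1
        funext n
        rcases n with _ | n <;> simp [prepend]
      rw [hz]
      cases z 0
      · exact ih h.1 _
      · exact ih h.2 _

/-- A finite computation: prefixes are extended until the relator can be evaluated, and length eight
is enough. -/
theorem relators_actTrivially : ∀ w ∈ relators, actsTrivially w 8 [] = true := by
  decide +kernel

theorem foldl_toV_relator {w : List Gen} (hw : w ∈ relators) :
    w.foldl (fun (h : thompsonV) (s : Gen) => s.toV * h) 1 = (1 : thompsonV) := by
  refine Subtype.ext (Equiv.ext fun z => ?_)
  have h := foldl_apply_of_actsTrivially (relators_actTrivially w hw) z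
  rw [prepend_nil] at h
  have hcoe : ∀ (l : List Gen) (f : thompsonV), (l.foldl (fun (h : thompsonV) (s : Gen) => s.toV * h) f).1 =
      l.foldl (fun (h : Equiv.Perm Cantor) (s : Gen) => s.perm * h) f.1 := by
    intro l
    induction l with
    | nil => intro f; rfl
    | cons s l ih => intro f; exact ih _
  rw [hcoe]
  exact h

theorem actWord_blockAction (w : List Gen) :
    actWord (fun s => blockAction s.toV) w = blockAction (w.foldl (fun (h : thompsonV) (s : Gen) => s.toV * h) 1) := by
  have : ∀ (l : List Gen) (f : thompsonV),
      l.foldl (fun (h : OPHomeo matX) (s : Gen) => blockAction s.toV * h) (blockAction f) =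
        blockAction (l.foldl (fun (h : thompsonV) (s : Gen) => s.toV * h) f) := by
    intro l
    induction l with
    | nil => intro f; rfl
    | cons s l ih => intro f; rw [List.foldl_cons, List.foldl_cons, ← map_mul, ih]
  rw [actWord, ← this, map_one]

end Relators

/-! ### A local rule describes at most one homeomorphism -/

section RuleUniqueness

variable {n : ℕ} {M : Matrix (Fin n) (Fin n) ℕ}

/-- A local rule with non-empty words on the right describes at most one homeomorphism. -/
theorem Implements.unique {h h' : OPHomeo M} {R : List (RuleEntry n)} (hh : Implements h R)
    (hh' : Implements h' R) (hR : ∀ e ∈ R, e.v' ≠ []) : h = h' := by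
  refine Subtype.ext (Homeomorph.ext fun q => ?_)
  obtain ⟨x, t, rfl⟩ := torusMk_surjective q
  have huniq : ∀ (e e' : RuleEntry n) (p p' i : ℤ), e ∈ R → e.AppliesAt x p → p ≤ i →
      i < p + e.v.length → e' ∈ R → e'.AppliesAt x p' → p' ≤ i → i < p' + e'.v.length →
      e = e' ∧ p = p' := fun e e' p p' i h1 h2 h3 h4 h5 h6 h7 h8 => by
    have := (hh.1 x i).unique (y₁ := (e, p)) (y₂ := (e', p')) ⟨h1, h2, h3, h4⟩ ⟨h5, h6, h7, h8⟩
    exact Prod.ext_iff.1 this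
  refine eq_of_same_pieces (P := fun p l => 0 < l ∧ ∃ e ∈ R, e.AppliesAt x p ∧ e.v.length = l)
    ?_ ?_ ?_ ?_ t
  · intro i
    obtain ⟨⟨e, p⟩, ⟨he, ha, h1, h2⟩, -⟩ := hh.1 x i
    dsimp only at h1 h2
    exact ⟨p, e.v.length, ⟨by omega, e, he, ha, rfl⟩, h1, h2⟩
  · rintro p l ⟨hl, e, he, ha, rfl⟩
    obtain ⟨⟨e', p'⟩, ⟨he', ha', h1, h2⟩, -⟩ := hh.1 x (p + e.v.length)
    dsimp only at he' ha' h1 h2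
    -- If the piece covering the cell after `e` began earlier, it would share the last cell of `e`
    -- and coincide with it.
    rcases h1.lt_or_eq with h3 | rfl
    · obtain ⟨rfl, rfl⟩ := huniq e e' p p' (p + e.v.length - 1) he ha (by omega) (by omega)
        he' ha' (by omega) (by omega)
      omega
    · exact ⟨_, by omega, e', he', ha', rfl⟩
  · rintro p l ⟨hl, e, he, ha, rfl⟩
    obtain ⟨⟨e', p'⟩, ⟨he', ha', h1, h2⟩, -⟩ := hh.1 x (p - 1)
    dsimp only at he' ha' h1 h2
    have h3 : p' + e'.v.length = p := by
      by_contra hne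
      obtain ⟨rfl, rfl⟩ := huniq e e' p p' p he ha le_rfl (by omega) he' ha' (by omega) (by omega)
      omega
    refine ⟨e'.v.length, by omega, e', he', ?_, rfl⟩
    rwa [← h3, add_sub_cancel_right]
  · rintro p l ⟨hl, e, he, ha, rfl⟩
    obtain ⟨y, hy, hys⟩ := hh.2 x e he p ha
    obtain ⟨y', hy', hys'⟩ := hh'.2 x e he p ha
    have hl' : (0 : ℝ) < e.v.length := Nat.cast_pos.2 hl
    refine ⟨y, y', e.v'.length, fun s => s / e.v.length * e.v'.length,
      List.length_pos_of_ne_nil (hR e he), by simp, ?_, fun i hi => ?_, fun s hs => ?_⟩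
    · dsimp only
      rw [div_self hl'.ne', one_mul]
    · have h1 := hy ⟨i, hi⟩
      have h2 := hy' ⟨i, hi⟩
      rw [zero_add] at h1 h2
      exact h1.trans h2.symm
    · have hs' : s / e.v.length ∈ Set.Icc (0 : ℝ) 1 :=
        ⟨div_nonneg hs.1 hl'.le, (div_le_one hl').2 hs.2⟩
      have h1 := hys _ hs'
      have h2 := hys' _ hs'
      rw [div_mul_cancel₀ _ hl'.ne'] at h1 h2
      exact ⟨h1, h2⟩

end RuleUniqueness

/-! ### The rules cut every configuration unambiguously -/

section RuleCover

/-- The entry matches the window `W`, the cells at distance at most `2` on the left and `3` on the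
right of a given cell, so that the given cell has index `j` in the piece. -/
def RuleEntry.matchesWindow {n : ℕ} (e : RuleEntry n) (W : List (Fin n)) (j : ℕ) : Bool :=
  decide (j < e.v.length) && (List.range (e.u ++ e.v ++ e.w).length).all fun k =>
    -- The given cell has index `2` in the window. `Gen.rule_window` ensures that the subtraction is
    -- not truncated and that the index stays inside the window.
    W[2 - (j + e.u.length) + k]? == (e.u ++ e.v ++ e.w)[k]?

/-- Every cell with a given neighborhood lies in exactly one piece. -/
def coversWindow {n : ℕ} (R : List (RuleEntry n)) (W : List (Fin n)) : Bool :=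
  ((R ×ˢ [0, 1, 2]).filter fun q => q.1.matchesWindow W q.2).length == 1

/-- Whether an entry covers a given cell depends on six consecutive symbols, so all windows without
`02` can be inspected. -/
theorem Gen.coversWindow_rule : ∀ (s : Gen) (a b c d e f : Fin 3),
    !(a == 0 && b == 2) → !(b == 0 && c == 2) → !(c == 0 && d == 2) → !(d == 0 && e == 2) →
    !(e == 0 && f == 2) → coversWindow s.rule [a, b, c, d, e, f] = true := by
  intro s
  cases s <;> decide +kernel

theorem Gen.rule_window : ∀ s : Gen, ∀ e ∈ s.rule, ∀ j : Fin 3, (j : ℕ) < e.v.length →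
    j + e.u.length ≤ 2 ∧ 2 - (j + e.u.length) + (e.u ++ e.v ++ e.w).length ≤ 6 := by
  intro s
  cases s <;> decide +kernel

theorem Gen.rule_length : ∀ s : Gen, ∀ e ∈ s.rule, e.v.length ≤ 3 ∧ 0 < e.v'.length := by
  intro s
  cases s <;> decide +kernel

theorem matchesWindow_iff {s : Gen} {e : RuleEntry 3} (he : e ∈ s.rule) (x : VertexShift matX)
    (i : ℤ) {j : ℕ} (hj : j < 3) :
    e.matchesWindow [x.1 (i - 2), x.1 (i - 2 + 1), x.1 (i - 2 + 2), x.1 (i - 2 + 3), x.1 (i - 2 + 4),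
      x.1 (i - 2 + 5)] j = true ↔ j < e.v.length ∧ e.AppliesAt x (i - j) := by
  have hW : ∀ k : ℕ, k < 6 → [x.1 (i - 2), x.1 (i - 2 + 1), x.1 (i - 2 + 2), x.1 (i - 2 + 3),
      x.1 (i - 2 + 4), x.1 (i - 2 + 5)][k]? = some (x.1 (i - 2 + k)) := by
    intro k hk
    interval_cases k <;> simp
  rw [RuleEntry.matchesWindow, Bool.and_eq_true, decide_eq_true_iff]
  refine and_congr_right fun hjv => ?_
  obtain ⟨h1, h2⟩ := s.rule_window e he ⟨j, hj⟩ hjv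
  dsimp only at h1 h2
  rw [List.all_eq_true, RuleEntry.AppliesAt, OccursAt]
  constructor
  · intro h k
    have hk := k.2
    have := h k (List.mem_range.2 hk)
    rw [beq_iff_eq, hW _ (by omega), List.getElem?_eq_getElem hk, Option.some.injEq] at this
    refine Eq.trans (congrArg x.1 ?_) this
    omega
  · intro h k hk
    rw [List.mem_range] at hk
    have := h ⟨k, hk⟩
    rw [beq_iff_eq, hW _ (by omega), List.getElem?_eq_getElem hk, Option.some.injEq]
    refine Eq.trans (congrArg x.1 ?_) this
    dsimp only
    omega

theorem Gen.rule_cover (s : Gen) (x : VertexShift matX) (i : ℤ) : ∃! q : RuleEntry 3 × ℤ,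
    q.1 ∈ s.rule ∧ q.1.AppliesAt x q.2 ∧ q.2 ≤ i ∧ i < q.2 + q.1.v.length := by
  have hadj : ∀ k l : ℤ, k + 1 = l → !(x.1 k == 0 && x.1 l == 2) := by
    rintro k _ rfl
    have := (matX_eq_one_iff _ _).1 (x.2 k)
    rw [Bool.not_eq_true', Bool.and_eq_false_iff, beq_eq_false_iff_ne, beq_eq_false_iff_ne]
    tauto
  have hw := s.coversWindow_rule (x.1 (i - 2)) (x.1 (i - 2 + 1)) (x.1 (i - 2 + 2))
    (x.1 (i - 2 + 3)) (x.1 (i - 2 + 4)) (x.1 (i - 2 + 5)) (hadj _ _ (by ring))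
    (hadj _ _ (by ring)) (hadj _ _ (by ring)) (hadj _ _ (by ring)) (hadj _ _ (by ring))
  rw [coversWindow, beq_iff_eq, List.length_eq_one_iff] at hw
  obtain ⟨⟨e, j⟩, hej⟩ := hw
  have hmem : ∀ e' j', (e', j') = (e, j) ↔
      e' ∈ s.rule ∧ j' < 3 ∧ j' < e'.v.length ∧ e'.AppliesAt x (i - j') := by
    intro e' j'
    have hprod : (e', j') ∈ s.rule ×ˢ [0, 1, 2] ↔ e' ∈ s.rule ∧ j' ∈ [0, 1, 2] :=
      List.pair_mem_product
    rw [← List.mem_singleton, ← hej, List.mem_filter, hprod, and_assoc]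
    refine and_congr_right fun he' => ?_
    have h3 : j' ∈ [0, 1, 2] ↔ j' < 3 := by
      simp only [List.mem_cons, List.not_mem_nil, or_false]; omega
    rw [h3]
    exact and_congr_right fun hj' => matchesWindow_iff he' x i hj'
  obtain ⟨h1, h2, h3, h4⟩ := (hmem e j).1 rfl
  refine ⟨(e, i - j), ⟨h1, h4, by dsimp only; omega, by dsimp only; omega⟩, ?_⟩
  rintro ⟨e', p⟩ ⟨h5, h6, h7, h8⟩
  dsimp only at h5 h6 h7 h8
  have h9 := (s.rule_length e' h5).1
  have hp : i - ((i - p).toNat : ℤ) = p := by omega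
  have := (hmem e' (i - p).toNat).2 ⟨h5, by omega, by omega, by rwa [hp]⟩
  obtain ⟨rfl, rfl⟩ := Prod.ext_iff.1 this
  dsimp only at hp ⊢
  rw [hp]

end RuleCover

/-! ### The generators implement their local rules -/

section Generators

theorem Gen.isSome_actPrefix (s : Gen) (b c : Bool) : (s.actPrefix [b, c]).isSome := by
  cases s <;> cases b <;> cases c <;> rfl

theorem Gen.length_getD_actPrefix (s : Gen) (b c : Bool) :
    0 < ((s.actPrefix [b, c]).getD []).length := by
  cases s <;> cases b <;> cases c <;> decide

/-- The table of a generator on the words of length `2`. -/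
def Gen.table (s : Gen) : UniformTable s.toV.1 where
  depth := 2
  value u := (s.actPrefix u).getD []
  depth_pos := two_pos
  apply_prepend u hu z := by
    obtain ⟨b, c, rfl⟩ := List.length_eq_two.1 hu
    obtain ⟨v, hv⟩ := Option.isSome_iff_exists.1 (s.isSome_actPrefix b c)
    rw [hv]
    exact s.perm_prepend hv z
  value_length_pos u hu := by
    obtain ⟨b, c, rfl⟩ := List.length_eq_two.1 hu
    exact s.length_getD_actPrefix b c

/-- The word that replaces the first two digits of a block, when a generator acts on it. -/
def Gen.replace (s : Gen) (b c : Bool) : List Bool := (s.actPrefix [b, c]).getD []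

theorem read_two {s : Gen} {x : VertexShift matX} {b c : Bool} (h0 : blockCode x 0 = b)
    (h1 : blockCode x 1 = c) : s.table.value (s.table.read x) = s.replace b c := by
  have : s.table.read x = [b, c] := by
    rw [← h0, ← h1]; rfl
  rw [this]; rfl

theorem blockCode_zero {x : VertexShift matX} {b : Bool} (h : x.1 1 = bitSymbol b) :
    blockCode x 0 = b := by
  refine Eq.trans (decide_eq_decide.2 ?_) (decide_bitSymbol b)
  rw [← h]
  refine and_iff_left fun j hj => ?_
  obtain rfl : j = 0 := by omega
  rw [VertexShift.shift_apply, Nat.cast_zero, zero_add, h]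
  exact bitSymbol_ne_two b

theorem blockCode_one {x : VertexShift matX} {b c : Bool} (h : x.1 1 = bitSymbol b)
    (h' : x.1 2 = bitSymbol c) : blockCode x 1 = c := by
  refine Eq.trans (decide_eq_decide.2 ?_) (decide_bitSymbol c)
  rw [← h']
  refine and_iff_left fun j hj => ?_
  have hj' : j = 0 ∨ j = 1 := by omega
  rcases hj' with rfl | rfl
  · rw [VertexShift.shift_apply, Nat.cast_zero, zero_add, h]
    exact bitSymbol_ne_two b
  · rw [VertexShift.shift_apply, Nat.cast_one, one_add_one_eq_two, h']
    exact bitSymbol_ne_two c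

/-- A block begins at cell `0`, its first piece has length `l`, and the image of this piece is
`2 w`. -/
def FirstPiece (s : Gen) (x : VertexShift matX) (l : ℕ) (w : List Bool) : Prop :=
  x.1 0 = 2 ∧ s.table.span x = l ∧ s.table.outBits x = w

theorem firstPiece_one (s : Gen) {x : VertexShift matX} (h0 : x.1 0 = 2) (h1 : x.1 1 = 2) :
    FirstPiece s x 1 (trim (s.replace false false)) := by
  have hspan : s.table.span x = 1 :=
    s.table.span_eq one_pos (by omega) (Or.inl (by exact_mod_cast h1)) fun i _ _ => by omega
  have hb : IsBlock x 1 := ⟨one_pos, h0, by exact_mod_cast h1, fun i _ _ => by omega⟩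
  refine ⟨h0, hspan, ?_⟩
  rw [UniformTable.outBits, hspan, if_pos (by exact_mod_cast h1),
    read_two (blockCode_of_ge hb (by omega)) (blockCode_of_ge hb (by omega))]

theorem firstPiece_two (s : Gen) {x : VertexShift matX} {b : Bool} (h0 : x.1 0 = 2)
    (h1 : x.1 1 = bitSymbol b) (h2 : x.1 2 = 2) :
    FirstPiece s x 2 (trim (s.replace b false)) := by
  have hmid : ∀ i : ℕ, 0 < i → i < 2 → x.1 i ≠ 2 := fun i h h' => by
    obtain rfl : i = 1 := by omega
    rw [Nat.cast_one, h1]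
    exact bitSymbol_ne_two b
  have hspan : s.table.span x = 2 :=
    s.table.span_eq two_pos (show 2 ≤ 2 + 1 by omega) (Or.inl (by exact_mod_cast h2)) hmid
  have hb : IsBlock x 2 := ⟨two_pos, h0, by exact_mod_cast h2, hmid⟩
  refine ⟨h0, hspan, ?_⟩
  rw [UniformTable.outBits, hspan, if_pos (by exact_mod_cast h2),
    read_two (blockCode_zero h1) (blockCode_of_ge hb (by omega))]

theorem firstPiece_three (s : Gen) {x : VertexShift matX} {b c : Bool} (h0 : x.1 0 = 2)
    (h1 : x.1 1 = bitSymbol b) (h2 : x.1 2 = bitSymbol c) :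
    FirstPiece s x 3 (if x.1 3 = 2 then trim (s.replace b c) else s.replace b c) := by
  have hmid : ∀ i : ℕ, 0 < i → i < 3 → x.1 i ≠ 2 := fun i h h' => by
    have hi : i = 1 ∨ i = 2 := by omega
    rcases hi with rfl | rfl
    · rw [Nat.cast_one, h1]
      exact bitSymbol_ne_two b
    · rw [Nat.cast_two, h2]
      exact bitSymbol_ne_two c
  have hspan : s.table.span x = 3 := s.table.span_eq three_pos le_rfl (Or.inr rfl) hmid
  refine ⟨h0, hspan, ?_⟩
  rw [UniformTable.outBits, hspan, read_two (blockCode_zero h1) (blockCode_one h1 h2)]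
  rfl

theorem firstPiece_three_of_ne (s : Gen) {x : VertexShift matX} {b c : Bool} (h0 : x.1 0 = 2)
    (h1 : x.1 1 = bitSymbol b) (h2 : x.1 2 = bitSymbol c) (h3 : x.1 3 ≠ 2) :
    FirstPiece s x 3 (s.replace b c) := by
  have := firstPiece_three s h0 h1 h2
  rwa [if_neg h3] at this

/-- A `0` is not followed by `2`, so the block continues. Hence entries with `v` ending in `0` need
no right context. -/
theorem firstPiece_three_zero (s : Gen) {x : VertexShift matX} {b : Bool} (h0 : x.1 0 = 2)
    (h1 : x.1 1 = bitSymbol b) (h2 : x.1 2 = 0) : FirstPiece s x 3 (s.replace b false) :=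
  firstPiece_three_of_ne s h0 h1 h2 fun h3 => (matX_eq_one_iff _ _).1 (x.2 2) ⟨h2, h3⟩

/-- If the output does not end in zero, it does not matter whether the block ends, and again no
right context is needed. -/
theorem firstPiece_three_of_trim (s : Gen) {x : VertexShift matX} {b c : Bool} (h0 : x.1 0 = 2)
    (h1 : x.1 1 = bitSymbol b) (h2 : x.1 2 = bitSymbol c)
    (h : trim (s.replace b c) = s.replace b c) : FirstPiece s x 3 (s.replace b c) := by
  have := firstPiece_three s h0 h1 h2
  rwa [h, ite_self] at this

theorem firstPiece_three_of_end (s : Gen) {x : VertexShift matX} {b c : Bool} (h0 : x.1 0 = 2)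
    (h1 : x.1 1 = bitSymbol b) (h2 : x.1 2 = bitSymbol c) (h3 : x.1 3 = 2) :
    FirstPiece s x 3 (trim (s.replace b c)) := by
  have := firstPiece_three s h0 h1 h2
  rwa [if_pos h3] at this

/-- The map `G` replaces the word `v` at cell `0` of `x` by `v'`, with constant slope. -/
def ReplacesAt (G : MappingTorus matX → MappingTorus matX) (x : VertexShift matX) (l : ℕ)
    (v' : List (Fin 3)) : Prop :=
  ∃ y : VertexShift matX, OccursAt v' y 0 ∧ ∀ s ∈ Set.Icc (0 : ℝ) 1,
    G (torusMk x (s * l)) = torusMk y (s * v'.length)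

theorem occursAt_image_of_two {g : Equiv.Perm Cantor} (T : UniformTable g) {x : VertexShift matX}
    (h0 : x.1 0 = 2) :
    OccursAt (2 :: (T.outBits x).map bitSymbol) (T.code.image x) 0 := by
  intro j
  have hj := j.2
  have ho := T.out_of_two h0
  rw [zero_add, T.image_apply_of_lt (T.start_eq_zero_of_two h0) (by rw [ho]; exact hj)]
  simp only [ho]
  rfl

theorem FirstPiece.replacesAt {s : Gen} {x : VertexShift matX} {l : ℕ} {w : List Bool}
    (h : FirstPiece s x l w) (hl : l ≤ 3) (hw : w.length ≤ 2) :
    ReplacesAt s.table.code.map x l (2 :: w.map bitSymbol) := by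
  obtain ⟨h0, rfl, rfl⟩ := h
  refine ⟨s.table.code.image x, occursAt_image_of_two _ h0, fun t ht => ?_⟩
  have hl0 : (0 : ℝ) ≤ s.table.span x := Nat.cast_nonneg _
  rw [s.table.map_of_two h0 ⟨mul_nonneg ht.1 hl0, mul_le_of_le_one_left hl0 ht.2⟩,
    restretch_mul_of_le_three (s.table.span_spec x).1 hl (Nat.succ_pos _) (by omega) ht,
    List.length_cons, List.length_map]

/-- If a generator lengthens the first piece from three to four symbols, then the first two symbols
are stretched to three symbols. -/
theorem FirstPiece.replacesAt_of_three_four {s : Gen} {x : VertexShift matX} {b c d : Bool}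
    (h : FirstPiece s x 3 [b, c, d]) :
    ReplacesAt s.table.code.map x 2 [2, bitSymbol b, bitSymbol c] ∧
      ReplacesAt s.table.code.map (x.shift 2) 1 [bitSymbol d] := by
  obtain ⟨h0, hl, hw⟩ := h
  have hocc := occursAt_image_of_two s.table h0
  have hmap : ∀ t ∈ Set.Icc (0 : ℝ) 3, s.table.code.map (torusMk x t) =
      torusMk (s.table.code.image x) (pushRight t) := fun t ht => by
    rw [s.table.map_of_two h0 (by rw [hl]; exact_mod_cast ht), hl, hw, ← restretch_three_four]
    rfl
  rw [hw] at hocc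
  constructor
  · refine ⟨s.table.code.image x, fun j => ?_, fun t ht => ?_⟩
    · have := hocc ⟨j, j.2.trans (by simp)⟩
      rw [this]
      fin_cases j <;> rfl
    · rw [hmap _ ⟨by have := ht.1; positivity, by have := ht.2; push_cast; linarith⟩,
        pushRight_of_le (by have := ht.2; push_cast; linarith)]
      congr 1
      simp only [List.length_cons, List.length_nil]
      push_cast
      ring
  · refine ⟨(s.table.code.image x).shift 3, fun j => ?_, fun t ht => ?_⟩
    · have := hocc ⟨3, by simp⟩
      fin_cases j
      exact this
    · rw [torusMk_shift, torusMk_shift,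
        hmap _ ⟨by have := ht.1; push_cast; linarith, by have := ht.2; push_cast; linarith⟩,
        pushRight_of_ge (by have := ht.1; push_cast; linarith)]
      congr 1
      simp only [List.length_cons, List.length_nil]
      push_cast
      ring

theorem replacesAt_of_far (s : Gen) {x : VertexShift matX} {a : Fin 3} (h0 : x.1 0 = a)
    (hne : a ≠ 2) (h1 : x.1 (-1) ≠ 2) (h2 : x.1 (-2) ≠ 2) :
    ReplacesAt s.table.code.map x 1 [a] := by
  have hfar : ∀ d : ℕ, d ≤ s.table.depth → x.1 (-(d : ℤ)) ≠ 2 := by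
    intro d hd
    change d ≤ 2 at hd
    interval_cases d
    · simpa [h0] using hne
    · simpa using h1
    · simpa using h2
  obtain ⟨hs, -, hmap⟩ := s.table.copy_of_far hfar
  refine ⟨s.table.code.image x, fun j => ?_, fun t ht => ?_⟩
  · fin_cases j
    simpa [h0] using s.table.image_apply_zero hs
  · simpa using hmap t ht

/-- After `21`, the third generator copies the next digit. -/
theorem replacesAt_c_of_one {x : VertexShift matX} {b : Bool} (h0 : x.1 0 = bitSymbol b)
    (h1 : x.1 (-1) = 1) : ReplacesAt Gen.c.table.code.map x 1 [bitSymbol b] := by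
  -- Right after `21` the digit is the third cell of a piece that grows from three to four symbols;
  -- otherwise both cells before it differ from `2` and it is simply copied.
  by_cases h2 : x.1 (-2) = 2
  · set z := x.shift (-2) with hz
    have hx : x = z.shift 2 := by rw [hz, VertexShift.shift_shift]; exact x.shift_zero.symm
    have hz0 : z.1 0 = 2 := h2
    have hz1 : z.1 1 = bitSymbol true := h1
    have hz2 : z.1 2 = bitSymbol b := h0
    rw [hx]
    cases b
    · exact (firstPiece_three_zero .c hz0 hz1 hz2).replacesAt_of_three_four.2
    · exact (firstPiece_three_of_trim .c hz0 hz1 hz2 (by decide)).replacesAt_of_three_four.2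
  · exact replacesAt_of_far _ h0 (bitSymbol_ne_two b) (by rw [h1]; decide) h2

theorem Gen.replacesAt_of_mem_rule (s : Gen) {e : RuleEntry 3} (he : e ∈ s.rule)
    {x : VertexShift matX} (h : e.AppliesAt x 0) :
    ReplacesAt s.table.code.map x e.v.length e.v' := by
  cases s <;>
  simp only [Gen.rule, bits, List.flatMap_cons, List.flatMap_nil, List.map_cons, List.map_nil,
    List.mem_cons, List.not_mem_nil, or_false, List.append_nil, List.cons_append,
    List.nil_append] at he
  · rcases he with rfl | rfl | rfl | rfl | rfl | rfl | rfl | rfl |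
      rfl | rfl | rfl | rfl | rfl | rfl | rfl | rfl <;>
    simp [RuleEntry.AppliesAt, OccursAt, Fin.forall_fin_succ] at h
    iterate 8
      · exact replacesAt_of_far _ h.2.2 (by decide) (by rw [h.2.1]; decide)
          (by rw [h.1]; decide)
    · exact (firstPiece_one .a h.1 h.2).replacesAt (by decide) (by decide)
    · exact (firstPiece_three_zero .a (b := false) h.1 h.2.1 h.2.2).replacesAt (by decide) (by decide)
    · exact (firstPiece_three_of_ne .a (b := false) (c := true)
        h.1 h.2.1 h.2.2.1 (by rw [h.2.2.2]; decide)).replacesAt (by decide) (by decide)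
    · exact (firstPiece_three_of_ne .a (b := false) (c := true)
        h.1 h.2.1 h.2.2.1 (by rw [h.2.2.2]; decide)).replacesAt (by decide) (by decide)
    -- The block `201` ends here; its output digits `00` are trimmed away and only `2` remains.
    · exact (firstPiece_three_of_end .a (b := false) (c := true)
        h.1 h.2.1 h.2.2.1 h.2.2.2).replacesAt (by decide) (by decide)
    · exact (firstPiece_two .a (b := true) h.1 h.2.1 h.2.2).replacesAt (by decide) (by decide)
    · exact (firstPiece_three_zero .a (b := true) h.1 h.2.1 h.2.2).replacesAt (by decide) (by decide)
    · exact (firstPiece_three_of_trim .a (b := true) (c := true) h.1 h.2.1 h.2.2 (by decide)).replacesAt (by decide) (by decide)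
  · rcases he with rfl | rfl | rfl | rfl | rfl | rfl | rfl | rfl |
      rfl | rfl | rfl | rfl | rfl | rfl | rfl | rfl | rfl <;>
    simp [RuleEntry.AppliesAt, OccursAt, Fin.forall_fin_succ] at h
    iterate 8
      · exact replacesAt_of_far _ h.2.2 (by decide) (by rw [h.2.1]; decide)
          (by rw [h.1]; decide)
    · exact (firstPiece_one .b h.1 h.2).replacesAt (by decide) (by decide)
    · exact (firstPiece_three_zero .b (b := false) h.1 h.2.1 h.2.2).replacesAt (by decide) (by decide)
    · exact (firstPiece_three_of_ne .b (b := false) (c := true)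
        h.1 h.2.1 h.2.2.1 (by rw [h.2.2.2]; decide)).replacesAt (by decide) (by decide)
    · exact (firstPiece_three_of_ne .b (b := false) (c := true)
        h.1 h.2.1 h.2.2.1 (by rw [h.2.2.2]; decide)).replacesAt (by decide) (by decide)
    · exact (firstPiece_three_of_end .b (b := false) (c := true)
        h.1 h.2.1 h.2.2.1 h.2.2.2).replacesAt (by decide) (by decide)
    · exact (firstPiece_two .b (b := true) h.1 h.2.1 h.2.2).replacesAt (by decide) (by decide)
    · exact (firstPiece_three_of_ne .b (b := true) (c := false)
        h.1 h.2.1 h.2.2.1 (by rw [h.2.2.2]; decide)).replacesAt (by decide) (by decide)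
    · exact (firstPiece_three_of_ne .b (b := true) (c := false)
        h.1 h.2.1 h.2.2.1 (by rw [h.2.2.2]; decide)).replacesAt (by decide) (by decide)
    · exact (firstPiece_three_of_trim .b (b := true) (c := true) h.1 h.2.1 h.2.2 (by decide)).replacesAt (by decide) (by decide)
  · rcases he with rfl | rfl | rfl | rfl | rfl | rfl | rfl | rfl |
      rfl | rfl | rfl | rfl <;>
    simp [RuleEntry.AppliesAt, OccursAt, Fin.forall_fin_succ] at h
    iterate 4
      · exact replacesAt_of_far _ h.2.2 (by decide) (by rw [h.2.1]; decide)
          (by rw [h.1]; decide)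
    · exact replacesAt_c_of_one (b := false) h.2 h.1
    · exact replacesAt_c_of_one (b := true) h.2 h.1
    · exact (firstPiece_one .c h.1 h.2).replacesAt (by decide) (by decide)
    · exact (firstPiece_three_zero .c (b := false) h.1 h.2.1 h.2.2).replacesAt (by decide) (by decide)
    · exact (firstPiece_three_of_trim .c (b := false) (c := true) h.1 h.2.1 h.2.2 (by decide)).replacesAt (by decide) (by decide)
    -- The table rewrites three cells, while the entry replaces only `21`: the third cell is
    -- translated and belongs to a copying entry.
    · exact (firstPiece_three_zero .c (b := true) h.1 h.2.1 h.2.2).replacesAt_of_three_four.1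
    · exact (firstPiece_three_of_trim .c (b := true) (c := true) h.1 h.2.1 h.2.2
        (by decide)).replacesAt_of_three_four.1
    · exact (firstPiece_two .c (b := true) h.1 h.2.1 h.2.2).replacesAt (by decide) (by decide)

theorem Gen.implements (s : Gen) : Implements (blockAction s.toV) s.rule := by
  refine ⟨s.rule_cover, fun x e he p ha => ?_⟩
  have ha' : e.AppliesAt (x.shift p) 0 := fun j => by
    refine Eq.trans (congrArg x.1 ?_) (ha j)
    ring
  obtain ⟨y, hy, hys⟩ := s.replacesAt_of_mem_rule he ha'
  refine ⟨y, hy, fun t ht => ?_⟩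
  rw [blockAction_eq_map s.table, ← hys t ht, torusMk_shift, add_comm]

end Generators

/-! ### The main theorem -/

theorem theorem2 :
    ∃ F : Gen → OPHomeo matX,
      -- each local rule describes exactly one homeomorphism, and it is piecewise linear
      (∀ s, Implements (F s) s.rule ∧ (∀ h, Implements h s.rule → h = F s) ∧
        IsPiecewiseLinear (F s)) ∧
      -- every relator acts as the identity homeomorphism
      (∀ w ∈ relators, actWord F w = 1) ∧
      -- the embedding of `V` in the mapping class group
      ∃ ι : thompsonV →* MCG matX, Function.Injective ι ∧
        (∀ s : Gen, ι s.toV = QuotientGroup.mk (F s)) ∧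
        -- the quotient map splits over the image of the embedding
        ∃ σ : ι.range →* OPHomeo matX,
          (∀ m, QuotientGroup.mk (σ m) = (m : MCG matX)) ∧
          (∀ m, IsPiecewiseLinear (σ m)) ∧
          (∀ s : Gen, σ (ι.rangeRestrict s.toV) = F s) := by
  refine ⟨fun s => blockAction s.toV, fun s => ⟨s.implements, fun h hh => ?_,
    isPiecewiseLinear_blockAction _⟩, fun w hw => ?_, ?_⟩
  · exact hh.unique s.implements fun e he => List.ne_nil_of_length_pos (s.rule_length e he).2
  · rw [actWord_blockAction, foldl_toV_relator hw, map_one]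
  · let ι := (QuotientGroup.mk' (isotopicToId matX)).comp blockAction
    -- The embedding is an isomorphism onto its range, and the section is its inverse followed by
    -- `blockAction`.
    let e := MonoidHom.ofInjective (f := ι) mk_blockAction_injective
    have he : ∀ g, e g = ι.rangeRestrict g := fun g => rfl
    refine ⟨ι, mk_blockAction_injective, fun s => rfl, blockAction.comp e.symm.toMonoidHom,
      fun m => ?_, fun m => isPiecewiseLinear_blockAction _, fun s => ?_⟩
    · obtain ⟨g, rfl⟩ := e.surjective m
      change ι (e.symm (e g)) = _
      rw [e.symm_apply_apply]
      rfl
    · change blockAction (e.symm (ι.rangeRestrict s.toV)) = _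
      rw [← he, e.symm_apply_apply]
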